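/- Let $W\in L^\infty(\mathbb R)$ be real-valued and nonnegative (almost everywhere), with compact (essential) support. For $\alpha\in\mathbb R$ let $S_\alpha=-\frac{d^2}{dx^2}+W+\alpha\delta$ be the operator in $L^2(\mathbb R)$ (complex-valued functions) acting by $S_\alpha y=-y''+Wy$ (derivatives in the weak sense on $\mathbb R\setminus\{0\}$) on the domain $$\operatorname{dom}S_\alpha=\{y\in W_2^2(\mathbb R\setminus\{0\}) : y(+0)=y(-0),\ y'(+0)-y'(-0)=\alpha\,y(0)\}.$$ Then there exists $\alpha_0\in(-\infty,0)$ such that for every $\alpha<\alpha_0$ the operator $S_\alpha$ has exactly one negative eigenvalue, and this eigenvalue is simple. Moreover, an explicit threshold is given by the function $$f(\alpha)=\alpha+2\int_{\mathbb R}W(x)\,e^{\alpha|x|}\,dx,\qquad \alpha\in\mathbb R:$$ it has exactly one real zero $\alpha_0$; one has $\alpha_0\le 0$, with $\alpha_0<0$ unless $W=0$ almost everywhere; and for every $\alpha<\alpha_0$ the operator $S_\alpha$ has exactly one negative eigenvalue, and this eigenvalue is simple. -/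

import Mathlib

open MeasureTheory Set Filter Topology
open scoped ENNReal ContDiff

noncomputable section

namespace DeltaSchrodinger

/-- The Hilbert space `L²(ℝ)` of complex-valued functions. -/
abbrev L2 : Type := Lp ℂ 2 (volume : Measure ℝ)

/-- `g` is the weak (distributional) derivative of `u` on `ℝ ∖ {0}`. -/
def IsWeakDeriv (u g : L2) : Prop :=
  ∀ φ : ℝ → ℝ, ContDiff ℝ ∞ φ → HasCompactSupport φ → tsupport φ ⊆ {0}ᶜ →
    ∫ x, deriv φ x • u x = -∫ x, φ x • g x

theorem integrable_smul_L2 {φ : ℝ → ℝ} (hφ : Continuous φ) (hc : HasCompactSupport φ) (u : L2) :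
    Integrable (fun x => φ x • u x) := by
  have h : LocallyIntegrable (u : ℝ → ℂ) := (Lp.memLp u).locallyIntegrable (by norm_num)
  exact h.integrable_smul_left_of_hasCompactSupport hφ hc

theorem IsWeakDeriv.add {u v g h : L2} (hu : IsWeakDeriv u g) (hv : IsWeakDeriv v h) :
    IsWeakDeriv (u + v) (g + h) := by
  intro φ h1 h2 h3
  have e1 : ∫ x, deriv φ x • (u + v : L2) x = ∫ x, (deriv φ x • u x + deriv φ x • v x) := by
    apply integral_congr_ae
    filter_upwards [Lp.coeFn_add u v] with x hx
    rw [hx, Pi.add_apply, smul_add]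
  have e2 : ∫ x, φ x • (g + h : L2) x = ∫ x, (φ x • g x + φ x • h x) := by
    apply integral_congr_ae
    filter_upwards [Lp.coeFn_add g h] with x hx
    rw [hx, Pi.add_apply, smul_add]
  have hd : Continuous (deriv φ) := h1.continuous_deriv (by simp)
  rw [e1, e2, integral_add (integrable_smul_L2 hd h2.deriv u) (integrable_smul_L2 hd h2.deriv v),
    integral_add (integrable_smul_L2 h1.continuous h2 g) (integrable_smul_L2 h1.continuous h2 h),
    hu φ h1 h2 h3, hv φ h1 h2 h3, neg_add]

theorem IsWeakDeriv.smul (c : ℂ) {u g : L2} (hu : IsWeakDeriv u g) :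
    IsWeakDeriv (c • u) (c • g) := by
  intro φ h1 h2 h3
  have e1 : ∫ x, deriv φ x • (c • u : L2) x = ∫ x, c • (deriv φ x • u x) := by
    apply integral_congr_ae
    filter_upwards [Lp.coeFn_smul c u] with x hx
    rw [hx, Pi.smul_apply, smul_comm]
  have e2 : ∫ x, φ x • (c • g : L2) x = ∫ x, c • (φ x • g x) := by
    apply integral_congr_ae
    filter_upwards [Lp.coeFn_smul c g] with x hx
    rw [hx, Pi.smul_apply, smul_comm]
  rw [e1, e2, integral_smul, integral_smul, hu φ h1 h2 h3, smul_neg]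

theorem IsWeakDeriv.zero : IsWeakDeriv 0 0 := by
  intro φ _ _ _
  have e1 : ∫ x, deriv φ x • (0 : L2) x = 0 := by
    apply integral_eq_zero_of_ae
    filter_upwards [Lp.coeFn_zero ℂ 2 (volume : Measure ℝ)] with x _
    simp
  have e2 : ∫ x, φ x • (0 : L2) x = 0 := by
    apply integral_eq_zero_of_ae
    filter_upwards [Lp.coeFn_zero ℂ 2 (volume : Measure ℝ)] with x _
    simp
  rw [e1, e2, neg_zero]

theorem IsWeakDeriv.unique {u g h : L2} (hg : IsWeakDeriv u g) (hh : IsWeakDeriv u h) :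
    g = h := by
  have hgl : LocallyIntegrable (g : ℝ → ℂ) := (Lp.memLp g).locallyIntegrable (by norm_num)
  have hhl : LocallyIntegrable (h : ℝ → ℂ) := (Lp.memLp h).locallyIntegrable (by norm_num)
  have key := IsOpen.ae_eq_zero_of_integral_contDiff_smul_eq_zero
    (U := ({0}ᶜ : Set ℝ)) isOpen_compl_singleton
    ((hgl.sub hhl).locallyIntegrableOn _) (fun φ h1 h2 h3 => by
      have e : ∀ x, φ x • ((g : ℝ → ℂ) - (h : ℝ → ℂ)) x = φ x • g x - φ x • h x :=
        fun x => smul_sub _ _ _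
      simp only [e]
      rw [integral_sub (integrable_smul_L2 h1.continuous h2 g)
        (integrable_smul_L2 h1.continuous h2 h), sub_eq_zero]
      exact neg_injective ((hg φ h1 h2 h3).symm.trans (hh φ h1 h2 h3)))
  have h0 : ∀ᵐ x : ℝ, x ∈ ({0}ᶜ : Set ℝ) := Measure.ae_ne volume 0
  apply Lp.ext
  filter_upwards [key, h0] with x hx h0
  exact sub_eq_zero.mp (hx h0)

/-- The weak derivative on `ℝ ∖ {0}` as an unbounded operator in `L²(ℝ)`; its domain is
the Sobolev space `W¹₂(ℝ ∖ {0})`. -/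
def weakDeriv : L2 →ₗ.[ℂ] L2 where
  domain :=
    { carrier := {u | ∃ g, IsWeakDeriv u g}
      add_mem' := fun ⟨_, h⟩ ⟨_, h'⟩ => ⟨_, h.add h'⟩
      zero_mem' := ⟨0, IsWeakDeriv.zero⟩
      smul_mem' := fun c _ ⟨_, h⟩ => ⟨_, h.smul c⟩ }
  toFun :=
    { toFun := fun u => u.2.choose
      map_add' := fun u v =>
        (u + v).2.choose_spec.unique (u.2.choose_spec.add v.2.choose_spec)
      map_smul' := fun c u => (c • u).2.choose_spec.unique (u.2.choose_spec.smul c) }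

theorem mem_weakDeriv_domain {u : L2} : u ∈ weakDeriv.domain ↔ ∃ g, IsWeakDeriv u g := Iff.rfl

theorem isWeakDeriv_weakDeriv (u : weakDeriv.domain) : IsWeakDeriv u (weakDeriv u) :=
  u.2.choose_spec

/-- The Sobolev space `W²₂(ℝ ∖ {0})`. -/
def W22 : Submodule ℂ L2 where
  carrier := {u | ∃ h : u ∈ weakDeriv.domain, weakDeriv ⟨u, h⟩ ∈ weakDeriv.domain}
  add_mem' := by
    rintro u v ⟨hu, hu'⟩ ⟨hv, hv'⟩
    refine ⟨add_mem hu hv, ?_⟩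
    have e : weakDeriv ⟨u + v, add_mem hu hv⟩ = weakDeriv ⟨u, hu⟩ + weakDeriv ⟨v, hv⟩ :=
      weakDeriv.map_add ⟨u, hu⟩ ⟨v, hv⟩
    rw [e]
    exact add_mem hu' hv'
  zero_mem' := by
    refine ⟨zero_mem _, ?_⟩
    have e : weakDeriv ⟨0, zero_mem _⟩ = 0 := weakDeriv.map_zero
    rw [e]
    exact zero_mem _
  smul_mem' := by
    rintro c u ⟨hu, hu'⟩
    refine ⟨Submodule.smul_mem _ c hu, ?_⟩
    have e : weakDeriv ⟨c • u, Submodule.smul_mem _ c hu⟩ = c • weakDeriv ⟨u, hu⟩ :=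
      weakDeriv.map_smul c ⟨u, hu⟩
    rw [e]
    exact Submodule.smul_mem _ c hu'

/-- The first weak derivative `y'`, as a linear map `W²₂(ℝ ∖ {0}) → W¹₂(ℝ ∖ {0})`. -/
def firstDeriv : W22 →ₗ[ℂ] weakDeriv.domain where
  toFun y := ⟨weakDeriv ⟨y, y.2.choose⟩, y.2.choose_spec⟩
  map_add' u v := Subtype.ext (weakDeriv.map_add ⟨u, u.2.choose⟩ ⟨v, v.2.choose⟩)
  map_smul' c u := Subtype.ext (weakDeriv.map_smul c ⟨u, u.2.choose⟩)

/-- The second weak derivative `y''`, as a linear map `W²₂(ℝ ∖ {0}) → L²(ℝ)`. -/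
def secondDeriv : W22 →ₗ[ℂ] L2 := weakDeriv.toFun ∘ₗ firstDeriv

/-- `u(+0) = c`: the continuous representative of `u` on `(0, ∞)` tends to `c` at `0`. -/
def HasRightTrace (u : L2) (c : ℂ) : Prop :=
  ∃ v : ℝ → ℂ, ContinuousOn v (Ioi 0) ∧ u =ᵐ[volume.restrict (Ioi 0)] v ∧
    Tendsto v (𝓝[>] 0) (𝓝 c)

/-- `u(-0) = c`: the continuous representative of `u` on `(-∞, 0)` tends to `c` at `0`. -/
def HasLeftTrace (u : L2) (c : ℂ) : Prop :=
  ∃ v : ℝ → ℂ, ContinuousOn v (Iio 0) ∧ u =ᵐ[volume.restrict (Iio 0)] v ∧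
    Tendsto v (𝓝[<] 0) (𝓝 c)

theorem HasRightTrace.add {u v : L2} {c d : ℂ} (hu : HasRightTrace u c) (hv : HasRightTrace v d) :
    HasRightTrace (u + v) (c + d) := by
  obtain ⟨f, hf, hf', hf''⟩ := hu
  obtain ⟨g, hg, hg', hg''⟩ := hv
  exact ⟨f + g, hf.add hg, EventuallyEq.trans (ae_restrict_of_ae (Lp.coeFn_add u v)) (hf'.add hg'),
    hf''.add hg''⟩

theorem HasLeftTrace.add {u v : L2} {c d : ℂ} (hu : HasLeftTrace u c) (hv : HasLeftTrace v d) :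
    HasLeftTrace (u + v) (c + d) := by
  obtain ⟨f, hf, hf', hf''⟩ := hu
  obtain ⟨g, hg, hg', hg''⟩ := hv
  exact ⟨f + g, hf.add hg, EventuallyEq.trans (ae_restrict_of_ae (Lp.coeFn_add u v)) (hf'.add hg'),
    hf''.add hg''⟩

theorem HasRightTrace.smul (a : ℂ) {u : L2} {c : ℂ} (hu : HasRightTrace u c) :
    HasRightTrace (a • u) (a * c) := by
  obtain ⟨f, hf, hf', hf''⟩ := hu
  exact ⟨a • f, hf.const_smul a, EventuallyEq.trans (ae_restrict_of_ae (Lp.coeFn_smul a u))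
    (hf'.const_smul a), hf''.const_smul a⟩

theorem HasLeftTrace.smul (a : ℂ) {u : L2} {c : ℂ} (hu : HasLeftTrace u c) :
    HasLeftTrace (a • u) (a * c) := by
  obtain ⟨f, hf, hf', hf''⟩ := hu
  exact ⟨a • f, hf.const_smul a, EventuallyEq.trans (ae_restrict_of_ae (Lp.coeFn_smul a u))
    (hf'.const_smul a), hf''.const_smul a⟩

theorem HasRightTrace.zero : HasRightTrace 0 0 :=
  ⟨0, continuousOn_const, ae_restrict_of_ae (Lp.coeFn_zero ℂ 2 volume), tendsto_const_nhds⟩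

theorem HasLeftTrace.zero : HasLeftTrace 0 0 :=
  ⟨0, continuousOn_const, ae_restrict_of_ae (Lp.coeFn_zero ℂ 2 volume), tendsto_const_nhds⟩

/-- The interface conditions at the origin: `y(+0) = y(-0) = c`, `y'(+0) = p`, `y'(-0) = q`
with `p - q = α c`. -/
def InterfaceCondition (α : ℝ) (y y' : L2) : Prop :=
  ∃ c p q : ℂ, HasRightTrace y c ∧ HasLeftTrace y c ∧ HasRightTrace y' p ∧ HasLeftTrace y' q ∧
    p - q = α * c

/-- `dom S_α`: all `y ∈ W²₂(ℝ ∖ {0})` with `y(+0) = y(-0)` and `y'(+0) - y'(-0) = α y(0)`. -/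
def domS (α : ℝ) : Submodule ℂ L2 where
  carrier := {y | ∃ h : y ∈ W22, InterfaceCondition α y (firstDeriv ⟨y, h⟩)}
  add_mem' := by
    rintro u v ⟨hu, c, p, q, h1, h2, h3, h4, h5⟩ ⟨hv, c', p', q', h1', h2', h3', h4', h5'⟩
    refine ⟨add_mem hu hv, c + c', p + p', q + q', h1.add h1', h2.add h2', ?_, ?_, ?_⟩
    · have e := congrArg Subtype.val (firstDeriv.map_add ⟨u, hu⟩ ⟨v, hv⟩)
      exact (congrArg (fun w => HasRightTrace w (p + p')) e).mpr (h3.add h3')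
    · have e := congrArg Subtype.val (firstDeriv.map_add ⟨u, hu⟩ ⟨v, hv⟩)
      exact (congrArg (fun w => HasLeftTrace w (q + q')) e).mpr (h4.add h4')
    · linear_combination h5 + h5'
  zero_mem' := by
    refine ⟨zero_mem _, 0, 0, 0, HasRightTrace.zero, HasLeftTrace.zero, ?_, ?_, by simp⟩
    · have e := congrArg Subtype.val firstDeriv.map_zero
      exact (congrArg (fun w => HasRightTrace w 0) e).mpr HasRightTrace.zero
    · have e := congrArg Subtype.val firstDeriv.map_zero
      exact (congrArg (fun w => HasLeftTrace w 0) e).mpr HasLeftTrace.zero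
  smul_mem' := by
    rintro a u ⟨hu, c, p, q, h1, h2, h3, h4, h5⟩
    refine ⟨Submodule.smul_mem _ a hu, a * c, a * p, a * q, h1.smul a, h2.smul a, ?_, ?_, ?_⟩
    · have e := congrArg Subtype.val (firstDeriv.map_smul a ⟨u, hu⟩)
      exact (congrArg (fun w => HasRightTrace w (a * p)) e).mpr (h3.smul a)
    · have e := congrArg Subtype.val (firstDeriv.map_smul a ⟨u, hu⟩)
      exact (congrArg (fun w => HasLeftTrace w (a * q)) e).mpr (h4.smul a)
    · linear_combination a * h5

theorem domS_le_W22 (α : ℝ) : domS α ≤ W22 := fun _ h => h.choose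

theorem memLp_potential_mul {W : ℝ → ℝ} (hW : MemLp W ∞ volume) (y : L2) :
    MemLp (fun x => (W x : ℂ) * y x) 2 volume :=
  (Lp.memLp y).mul (p := ∞) (q := 2) (r := 2) hW.ofReal

/-- Multiplication `y ↦ W y` by a bounded real potential, on `L²(ℝ)`. -/
def potentialMul (W : ℝ → ℝ) (hW : MemLp W ∞ volume) : L2 →ₗ[ℂ] L2 where
  toFun y := (memLp_potential_mul hW y).toLp
  map_add' u v := by
    rw [← MemLp.toLp_add]
    apply MemLp.toLp_congr
    filter_upwards [Lp.coeFn_add u v] with x hx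
    rw [hx]
    exact mul_add _ _ _
  map_smul' c u := by
    rw [RingHom.id_apply, ← MemLp.toLp_const_smul]
    apply MemLp.toLp_congr
    filter_upwards [Lp.coeFn_smul c u] with x hx
    simp only [hx, Pi.smul_apply, smul_eq_mul]
    ring

/-- The Schrödinger operator `S_α = -d²/dx² + W + α δ` in `L²(ℝ)`: it acts by
`S_α y = -y'' + W y` on `dom S_α`. -/
def S (W : ℝ → ℝ) (hW : MemLp W ∞ volume) (α : ℝ) : L2 →ₗ.[ℂ] L2 where
  domain := domS α
  toFun := (-secondDeriv + potentialMul W hW ∘ₗ W22.subtype) ∘ₗ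
    Submodule.inclusion (domS_le_W22 α)

theorem isWeakDeriv_firstDeriv (y : W22) : IsWeakDeriv y (firstDeriv y : L2) :=
  isWeakDeriv_weakDeriv ⟨y, y.2.choose⟩

theorem isWeakDeriv_secondDeriv (y : W22) : IsWeakDeriv (firstDeriv y : L2) (secondDeriv y) :=
  isWeakDeriv_weakDeriv (firstDeriv y)

theorem S_apply (W : ℝ → ℝ) (hW : MemLp W ∞ volume) (α : ℝ) (y : (S W hW α).domain) :
    S W hW α y = -secondDeriv ⟨y, domS_le_W22 α y.2⟩ + potentialMul W hW y := rfl

theorem mem_S_domain (W : ℝ → ℝ) (hW : MemLp W ∞ volume) (α : ℝ) (y : L2) :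
    y ∈ (S W hW α).domain ↔
      ∃ y' y'' : L2, IsWeakDeriv y y' ∧ IsWeakDeriv y' y'' ∧ InterfaceCondition α y y' := by
  constructor
  · rintro ⟨h, h'⟩
    exact ⟨_, _, isWeakDeriv_firstDeriv ⟨y, h⟩, isWeakDeriv_secondDeriv ⟨y, h⟩, h'⟩
  · rintro ⟨y', y'', h1, h2, h3⟩
    have e : weakDeriv ⟨y, y', h1⟩ = y' := (isWeakDeriv_weakDeriv ⟨y, y', h1⟩).unique h1
    have hy : y ∈ W22 := ⟨⟨y', h1⟩, by rw [e]; exact ⟨y'', h2⟩⟩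
    refine ⟨hy, ?_⟩
    rw [(isWeakDeriv_firstDeriv ⟨y, hy⟩).unique h1]
    exact h3

/-- The eigenspace `{y ∈ dom T : T y = z y}` of an unbounded operator `T` in `L²(ℝ)`. -/
def eigenspace (T : L2 →ₗ.[ℂ] L2) (z : ℂ) : Submodule ℂ L2 :=
  (LinearMap.ker (T.toFun - z • T.domain.subtype)).map T.domain.subtype

theorem mem_eigenspace (T : L2 →ₗ.[ℂ] L2) (z : ℂ) (y : L2) :
    y ∈ eigenspace T z ↔ ∃ h : y ∈ T.domain, T ⟨y, h⟩ = z • y := by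
  constructor
  · rintro ⟨w, hw, rfl⟩
    exact ⟨w.2, sub_eq_zero.mp hw⟩
  · rintro ⟨h, e⟩
    exact ⟨⟨y, h⟩, sub_eq_zero.mpr e, rfl⟩

/-- `z` is an eigenvalue of the unbounded operator `T`. -/
def IsEigenvalue (T : L2 →ₗ.[ℂ] L2) (z : ℂ) : Prop :=
  ∃ y : T.domain, (y : L2) ≠ 0 ∧ T y = z • (y : L2)

/-- `T` has exactly one negative eigenvalue, and that eigenvalue is simple, so that
the count is the same with and without multiplicity. -/
def HasExactlyOneNegativeEigenvalue (T : L2 →ₗ.[ℂ] L2) : Prop :=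
  ∃ μ : ℝ, μ < 0 ∧ IsEigenvalue T (μ : ℂ) ∧ Module.finrank ℂ (eigenspace T (μ : ℂ)) = 1 ∧
    ∀ ν : ℝ, ν < 0 → IsEigenvalue T (ν : ℂ) → ν = μ

/-- The threshold function `f(α) = α + 2 ∫ W(x) exp(α |x|) dx`. -/
def thresholdFn (W : ℝ → ℝ) (α : ℝ) : ℝ := α + 2 * ∫ x, W x * Real.exp (α * |x|)

end DeltaSchrodinger

end

/-!
Write `T = S_α`. Two facts carry the proof.

*At most one negative eigenvalue.* For `y, z ∈ dom T`, Green's identity on `ℝ ∖ {0}` gives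
`⟪z, T y⟫ = ⟪z', y'⟫ + ⟪z, W y⟫ + α y(0) conj z(0)` (`inner_S_apply`). Hence `T` is symmetric and its
quadratic form is nonnegative on functions vanishing at the origin. Two linearly independent
eigenfunctions with negative eigenvalues would span a plane on which the form is negative definite,
and this plane would contain a nonzero function vanishing at the origin. This yields both uniqueness
(`eigenvalue_unique`) and simplicity (`finrank_eigenspace_eq_one`), for every real `α`.
Green's identity needs absolutely continuous representatives, which weak derivatives have by the
du Bois-Reymond lemma (`IsWeakDeriv.exists_piecewisePrimitive`); these are handled through the
predicate `IsPrimitive`.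

*Existence below the threshold.* Since `W` vanishes outside some `[-R, R]`, for each `k ≥ 0` the
equation `-u'' + W u = -k² u` has on each half-line a solution equal to `exp (-k (|x| - R))` beyond
`R` (`exists_jostSolution`). As `W` is only measurable, the equation is solved in integrated form
(`exists_caratheodory_solution`). Let `m(k)` be the logarithmic derivative at `0` of such a solution,
in the coordinate `|x|`; it is continuous in `k`. Gluing the two solutions gives an eigenfunction
with eigenvalue `-k²` exactly when the sum `F(k)` of the two values of `m(k)` equals `α`
(`isEigenvalue_of_jostSolution`). Now `m(k) ≤ -k` gives `F(-α) ≤ 2α < α`. On the other hand `-F(0)`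
is the minimum of `∫ φ'² + W φ²` over functions with `φ(0) = 1`, so that the trial function
`φ = exp (α |x| / 2)` gives `-F(0) ≤ -α / 2 + ∫ W exp (α |x|) < -α` when `f(α) < 0`. The intermediate
value theorem provides the required `k > 0` (`exists_jostSolution_matching`).

Finally `f` is strictly increasing with `f(-2 ∫ W) ≤ 0 ≤ f(0) = 2 ∫ W`, which locates its only zero.
-/

namespace DeltaSchrodinger

/-! ### Primitives of locally integrable functions -/

/-- `a` is a primitive of the integrable function `b` on `I`; for an interval `I` this says that
`a` is locally absolutely continuous on `I` with derivative `b` almost everywhere. -/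
def IsPrimitive {E : Type*} [NormedAddCommGroup E] [NormedSpace ℝ E] (a b : ℝ → E)
    (I : Set ℝ) : Prop :=
  ∀ x ∈ I, ∀ y ∈ I, IntervalIntegrable b volume x y ∧ ∫ t in x..y, b t = a y - a x

theorem absolutelyContinuousOnInterval_const_add {E : Type*} [NormedAddCommGroup E]
    {f : ℝ → E} {x y : ℝ} (hf : AbsolutelyContinuousOnInterval f x y) (c : E) :
    AbsolutelyContinuousOnInterval (fun t => c + f t) x y := by
  simpa only [AbsolutelyContinuousOnInterval, dist_add_left] using hf

/-- Vector-valued form of `IntervalIntegrable.absolutelyContinuousOnInterval_intervalIntegral`. -/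
theorem absolutelyContinuousOnInterval_primitive {E : Type*} [NormedAddCommGroup E]
    [NormedSpace ℝ E] {f : ℝ → E} {x y : ℝ} (hf : IntervalIntegrable f volume x y) :
    AbsolutelyContinuousOnInterval (fun t => ∫ s in x..t, f s) x y := by
  have h := hf.norm.absolutelyContinuousOnInterval_intervalIntegral (c := x) left_mem_uIcc
  have hi : ∀ u ∈ uIcc x y, ∀ v ∈ uIcc x y, IntervalIntegrable f volume u v := fun u hu v hv =>
    hf.mono_set (uIcc_subset_uIcc hu hv)
  refine squeeze_zero' (Eventually.of_forall fun _ => Finset.sum_nonneg fun _ _ => dist_nonneg)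
    ?_ h
  refine eventually_inf_principal.mpr (Eventually.of_forall fun P hP => ?_)
  refine Finset.sum_le_sum fun i hi' => ?_
  obtain ⟨hu, hv⟩ := hP.1 i hi'
  have hx : x ∈ uIcc x y := left_mem_uIcc
  rw [dist_comm, dist_comm (∫ s in x..(P.2 i).1, ‖f s‖), dist_eq_norm, dist_eq_norm,
    intervalIntegral.integral_interval_sub_left (hi _ hx _ hv) (hi _ hx _ hu),
    intervalIntegral.integral_interval_sub_left (hi _ hx _ hv).norm (hi _ hx _ hu).norm]
  exact intervalIntegral.norm_integral_le_abs_integral_norm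

namespace IsPrimitive

section Linear

variable {E F : Type*} [NormedAddCommGroup E] [NormedSpace ℝ E] [NormedAddCommGroup F]
  [NormedSpace ℝ F] {a b c d : ℝ → E} {I J : Set ℝ}

theorem mono (h : IsPrimitive a b J) (hIJ : I ⊆ J) : IsPrimitive a b I :=
  fun x hx y hy => h x (hIJ hx) y (hIJ hy)

theorem add (h : IsPrimitive a b I) (h' : IsPrimitive c d I) :
    IsPrimitive (fun x => a x + c x) (fun x => b x + d x) I := by
  intro x hx y hy
  obtain ⟨h1, h2⟩ := h x hx y hy
  obtain ⟨h3, h4⟩ := h' x hx y hy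
  refine ⟨h1.add h3, ?_⟩
  rw [intervalIntegral.integral_add h1 h3, h2, h4]
  exact (add_sub_add_comm _ _ _ _).symm

theorem clm_comp [CompleteSpace E] [CompleteSpace F] (L : E →L[ℝ] F) (h : IsPrimitive a b I) :
    IsPrimitive (fun x => L (a x)) (fun x => L (b x)) I := by
  intro x hx y hy
  obtain ⟨h1, h2⟩ := h x hx y hy
  refine ⟨⟨L.integrable_comp h1.1, L.integrable_comp h1.2⟩, ?_⟩
  rw [L.intervalIntegral_comp_comm h1, h2, map_sub]

theorem neg (h : IsPrimitive a b I) : IsPrimitive (fun x => -a x) (fun x => -b x) I := by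
  intro x hx y hy
  obtain ⟨h1, h2⟩ := h x hx y hy
  refine ⟨h1.neg, ?_⟩
  rw [intervalIntegral.integral_neg, h2]
  rw [neg_sub, neg_sub_neg]

/-- Changing the functions off `I` is harmless when `I` is an interval. -/
theorem congr_ae [I.OrdConnected] (h : IsPrimitive a b I) (hac : EqOn a c I)
    (hbd : ∀ᵐ x, x ∈ I → b x = d x) : IsPrimitive c d I := by
  intro x hx y hy
  obtain ⟨h1, h2⟩ := h x hx y hy
  have hsub : uIoc x y ⊆ I := uIoc_subset_uIcc.trans (OrdConnected.uIcc_subset ‹_› hx hy)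
  have e : ∀ᵐ t, t ∈ uIoc x y → b t = d t := by
    filter_upwards [hbd] with t ht htI using ht (hsub htI)
  refine ⟨h1.congr_ae ((ae_restrict_iff' measurableSet_uIoc).mpr e), ?_⟩
  rw [← hac hx, ← hac hy, ← h2]
  exact (intervalIntegral.integral_congr_ae e).symm

theorem congr [I.OrdConnected] (h : IsPrimitive a b I) (hac : EqOn a c I) (hbd : EqOn b d I) :
    IsPrimitive c d I :=
  h.congr_ae hac (Eventually.of_forall hbd)

theorem comp_sub_left (h : IsPrimitive a b I) (r : ℝ) (hJ : MapsTo (fun x => r - x) J I) :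
    IsPrimitive (fun x => a (r - x)) (fun x => -b (r - x)) J := by
  intro x hx y hy
  obtain ⟨h1, h2⟩ := h _ (hJ hx) _ (hJ hy)
  constructor
  · have h3 := (h1.comp_sub_left r).neg
    simp only [sub_sub_cancel] at h3
    exact h3
  · rw [intervalIntegral.integral_neg, intervalIntegral.integral_comp_sub_left,
      intervalIntegral.integral_symm, neg_neg, h2]

theorem of_hasDerivAt [CompleteSpace E] (h : ∀ x, HasDerivAt a (b x) x) (hb : Continuous b) :
    IsPrimitive a b univ := fun x _ y _ =>
  ⟨hb.intervalIntegrable x y,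
    intervalIntegral.integral_eq_sub_of_hasDerivAt (fun t _ => h t) (hb.intervalIntegrable x y)⟩

theorem of_locallyIntegrable (hb : LocallyIntegrable b) (c : E) :
    IsPrimitive (fun x => c + ∫ t in (0 : ℝ)..x, b t) b univ := by
  have hi : ∀ x y : ℝ, IntervalIntegrable b volume x y := fun x y =>
    (hb.integrableOn_isCompact isCompact_uIcc).intervalIntegrable
  intro x _ y _
  refine ⟨hi x y, ?_⟩
  beta_reduce
  rw [← intervalIntegral.integral_add_adjacent_intervals (hi 0 x) (hi x y)]
  abel

/-- Primitives on two intervals with a common endpoint glue. -/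
theorem Icc_union_Ici {r s : ℝ} (h : IsPrimitive a b (Icc r s)) (h' : IsPrimitive a b (Ici s))
    (hrs : r ≤ s) : IsPrimitive a b (Ici r) := by
  have key : ∀ x ∈ Ici r, IntervalIntegrable b volume s x ∧ ∫ t in s..x, b t = a x - a s := by
    intro x hx
    rcases le_total x s with hxs | hxs
    · exact h s ⟨hrs, le_rfl⟩ x ⟨hx, hxs⟩
    · exact h' s self_mem_Ici x hxs
  intro x hx y hy
  obtain ⟨h1, h2⟩ := key x hx
  obtain ⟨h3, h4⟩ := key y hy
  refine ⟨h1.symm.trans h3, ?_⟩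
  rw [← intervalIntegral.integral_add_adjacent_intervals h1.symm h3,
    intervalIntegral.integral_symm, h2, h4]
  abel

theorem continuousOn_Icc {x y : ℝ} (h : IsPrimitive a b (Icc x y)) (hxy : x ≤ y) :
    ContinuousOn a (Icc x y) := by
  have hx : x ∈ Icc x y := ⟨le_rfl, hxy⟩
  have h1 := (h x hx y ⟨hxy, le_rfl⟩).1
  have h2 : ContinuousOn (fun t => a x + ∫ s in x..t, b s) (Icc x y) := by
    have := intervalIntegral.continuousOn_primitive_interval' h1 (left_mem_uIcc)
    rw [uIcc_of_le hxy] at this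
    exact continuousOn_const.add this
  refine h2.congr fun t ht => ?_
  simp only
  rw [(h x hx t ht).2]
  abel

theorem continuousOn_Ici {r : ℝ} (h : IsPrimitive a b (Ici r)) : ContinuousOn a (Ici r) := by
  intro x hx
  have h1 : IsPrimitive a b (Icc r (x + 1)) := h.mono Icc_subset_Ici_self
  have hx' : r ≤ x := hx
  have h2 := h1.continuousOn_Icc (by linarith) x ⟨hx, by linarith⟩
  refine h2.mono_of_mem_nhdsWithin ?_
  rw [← Ici_inter_Iic]
  exact inter_mem self_mem_nhdsWithin (mem_nhdsWithin_of_mem_nhds (Iic_mem_nhds (by linarith)))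

theorem continuous (h : IsPrimitive a b univ) : Continuous a := by
  rw [continuous_iff_continuousAt]
  intro x
  exact (h.mono (subset_univ (Ici (x - 1)))).continuousOn_Ici.continuousAt
    (Ici_mem_nhds (by linarith))

/-- If `a` is an integrable primitive of an integrable function on `[0, ∞)` then `a` vanishes at
infinity, so only the boundary term at `0` survives. -/
theorem integral_Ioi [CompleteSpace E] (h : IsPrimitive a b (Ici 0)) (ha : IntegrableOn a (Ioi 0))
    (hb : IntegrableOn b (Ioi 0)) : ∫ x in Ioi 0, b x = -a 0 := by
  have h1 := intervalIntegral_tendsto_integral_Ioi 0 hb tendsto_id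
  have h2 : Tendsto a atTop (𝓝 (a 0 + ∫ x in Ioi 0, b x)) := by
    refine (h1.const_add (a 0)).congr' ?_
    filter_upwards [eventually_ge_atTop 0] with x hx
    rw [id, (h 0 self_mem_Ici x hx).2]
    abel
  have h3 : a 0 + ∫ x in Ioi 0, b x = 0 := by
    refine IntegrableAtFilter.eq_zero_of_tendsto (μ := volume) ⟨Ioi 0, Ioi_mem_atTop 0, ha⟩ ?_ h2
    intro s hs
    obtain ⟨r, hr⟩ := mem_atTop_sets.mp hs
    refine top_unique ?_
    rw [← Real.volume_Ici (a := r)]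
    exact measure_mono fun x hx => hr x hx
  exact eq_neg_of_add_eq_zero_right h3

/-- If `a` is an integrable primitive of an integrable function on `(-∞, 0]` then `a` vanishes at
`-∞`, so only the boundary term at `0` survives. -/
theorem integral_Iio [CompleteSpace E] (h : IsPrimitive a b (Iic 0)) (ha : IntegrableOn a (Iio 0))
    (hb : IntegrableOn b (Iio 0)) : ∫ x in Iio 0, b x = a 0 := by
  rw [← integrableOn_Iic_iff_integrableOn_Iio] at hb
  have h1 := intervalIntegral_tendsto_integral_Iic 0 hb tendsto_id
  have h2 : Tendsto a atBot (𝓝 (a 0 - ∫ x in Iic 0, b x)) := by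
    refine (h1.const_sub (a 0)).congr' ?_
    filter_upwards [eventually_le_atBot 0] with x hx
    rw [id, (h x hx 0 self_mem_Iic).2, sub_sub_cancel]
  have h3 : a 0 - ∫ x in Iic 0, b x = 0 := by
    refine IntegrableAtFilter.eq_zero_of_tendsto (μ := volume) ⟨Iio 0, Iio_mem_atBot 0, ha⟩ ?_ h2
    intro s hs
    obtain ⟨r, hr⟩ := mem_atBot_sets.mp hs
    refine top_unique ?_
    rw [← Real.volume_Iic (a := r)]
    exact measure_mono fun x hx => hr x hx
  rw [← integral_Iic_eq_integral_Iio]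
  exact (sub_eq_zero.mp h3).symm

end Linear

section Product

variable {𝕜 : Type*} [RCLike 𝕜] {a a' b b' : ℝ → 𝕜} {I : Set ℝ}

/-- The product rule. -/
theorem mul [I.OrdConnected] (ha : IsPrimitive a a' I) (hb : IsPrimitive b b' I) :
    IsPrimitive (fun x => a x * b x) (fun x => a' x * b x + a x * b' x) I := by
  intro x hx y hy
  have hsub : uIcc x y ⊆ I := OrdConnected.uIcc_subset ‹_› hx hy
  have hia := (ha x hx y hy).1
  have hib := (hb x hx y hy).1
  set A : ℝ → 𝕜 := fun t => a x + ∫ s in x..t, a' s with hA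
  set B : ℝ → 𝕜 := fun t => b x + ∫ s in x..t, b' s with hB
  have eA : ∀ t ∈ uIcc x y, a t = A t := fun t ht => by
    simp only [hA]; rw [(ha x hx t (hsub ht)).2]; abel
  have eB : ∀ t ∈ uIcc x y, b t = B t := fun t ht => by
    simp only [hB]; rw [(hb x hx t (hsub ht)).2]; abel
  have acA : AbsolutelyContinuousOnInterval A x y := absolutelyContinuousOnInterval_const_add
    (absolutelyContinuousOnInterval_primitive hia) _
  have acB : AbsolutelyContinuousOnInterval B x y := absolutelyContinuousOnInterval_const_add
    (absolutelyContinuousOnInterval_primitive hib) _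
  have hi : IntervalIntegrable (fun t => a' t * B t + A t * b' t) volume x y :=
    (hia.mul_continuousOn acB.continuousOn).add (hib.continuousOn_mul acA.continuousOn)
  have acH : AbsolutelyContinuousOnInterval
      (fun t => A t * B t - ∫ s in x..t, (a' s * B s + A s * b' s)) x y :=
    (acA.fun_smul acB).fun_sub (absolutelyContinuousOnInterval_primitive hi)
  obtain ⟨C, hC⟩ := acH.const_of_ae_hasDerivAt_zero (by
    filter_upwards [hia.ae_hasDerivAt_integral, hib.ae_hasDerivAt_integral,
      hi.ae_hasDerivAt_integral] with t h1 h2 h3 ht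
    have d1 := (h1 ht x left_mem_uIcc).const_add (a x)
    have d2 := (h2 ht x left_mem_uIcc).const_add (b x)
    have d3 := (d1.mul d2).sub (h3 ht x left_mem_uIcc)
    refine d3.congr_deriv ?_
    exact sub_self (a' t * B t + A t * b' t))
  have e1 : EqOn (fun t => a' t * B t + A t * b' t) (fun t => a' t * b t + a t * b' t)
      (uIcc x y) := fun t ht => by simp only [eA t ht, eB t ht]
  refine ⟨hi.congr fun t ht => e1 (uIoc_subset_uIcc ht), ?_⟩
  beta_reduce
  rw [← intervalIntegral.integral_congr e1, eA y right_mem_uIcc, eB y right_mem_uIcc,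
    eA x left_mem_uIcc, eB x left_mem_uIcc]
  have h1 := hC x left_mem_uIcc
  have h2 := hC y right_mem_uIcc
  simp only [intervalIntegral.integral_same, sub_zero] at h1
  rw [h1, ← h2]
  abel

theorem const_mul (c : 𝕜) (h : IsPrimitive a a' I) :
    IsPrimitive (fun x => c * a x) (fun x => c * a' x) I :=
  h.clm_comp ((ContinuousLinearMap.mul ℝ 𝕜) c)

end Product

end IsPrimitive

/-! ### Weak derivatives and piecewise primitives -/

/-- The du Bois-Reymond lemma on an open interval. The point is that a test function with
vanishing integral is the derivative of a test function. -/
theorem ae_eq_const_of_integral_deriv_smul_eq_zero {U : Set ℝ} (hU : IsOpen U) [U.OrdConnected]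
    (hne : U.Nonempty) {w : ℝ → ℂ} (hw : LocallyIntegrable w)
    (h : ∀ φ : ℝ → ℝ, ContDiff ℝ ∞ φ → HasCompactSupport φ → tsupport φ ⊆ U →
      ∫ x, deriv φ x • w x = 0) :
    ∃ c : ℂ, ∀ᵐ x, x ∈ U → w x = c := by
  obtain ⟨x₀, hx₀⟩ := hne
  obtain ⟨r, hr, hball⟩ := Metric.nhds_basis_closedBall.mem_iff.mp (hU.mem_nhds hx₀)
  let f : ContDiffBump x₀ := ⟨r / 2, r, half_pos hr, half_lt_self hr⟩
  set φ₀ : ℝ → ℝ := f.normed volume with hφ₀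
  have s0 : ContDiff ℝ ∞ φ₀ := f.contDiff_normed
  have c0 : HasCompactSupport φ₀ := f.hasCompactSupport_normed
  have t0 : tsupport φ₀ ⊆ U := by rw [hφ₀, f.tsupport_normed_eq]; exact hball
  have i0 : ∫ x, φ₀ x = 1 := f.integral_normed
  have hint : ∀ φ : ℝ → ℝ, ContDiff ℝ ∞ φ → HasCompactSupport φ →
      Integrable fun x => φ x • w x := fun φ h1 h2 =>
    hw.integrable_smul_left_of_hasCompactSupport h1.continuous h2
  refine ⟨∫ x, φ₀ x • w x, ?_⟩
  have key := IsOpen.ae_eq_zero_of_integral_contDiff_smul_eq_zero hU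
    (f := fun x => w x - ∫ x, φ₀ x • w x)
    ((hw.sub (locallyIntegrable_const _)).locallyIntegrableOn _) (fun g h1 h2 h3 => ?_)
  · filter_upwards [key] with x hx hxU
    exact sub_eq_zero.mp (hx hxU)
  have hgi : Integrable g := h1.continuous.integrable_of_hasCompactSupport h2
  have h0i : Integrable φ₀ := s0.continuous.integrable_of_hasCompactSupport c0
  set m := ∫ x, g x with hm
  -- `ψ` has integral zero, so its primitive `Φ` is again a test function supported in `U`
  set ψ : ℝ → ℝ := fun x => g x - m * φ₀ x with hψ
  have sψ : ContDiff ℝ ∞ ψ := h1.sub (contDiff_const.mul s0)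
  have iψ : Integrable ψ := hgi.sub (h0i.const_mul m)
  have zψ : ∫ x, ψ x = 0 := by
    rw [integral_sub hgi (h0i.const_mul m), integral_const_mul, i0, ← hm]; ring
  set K := tsupport g ∪ tsupport φ₀ with hK
  have cK : IsCompact K := h2.isCompact.union c0.isCompact
  have neK : K.Nonempty := by
    refine ⟨x₀, Or.inr ?_⟩
    rw [hφ₀, f.tsupport_normed_eq]
    exact Metric.mem_closedBall_self hr.le
  have hKU : K ⊆ U := union_subset h3 t0
  have haK := cK.sInf_mem neK
  have hbK := cK.sSup_mem neK
  set a := sInf K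
  set b := sSup K
  have hIU : Icc a b ⊆ U := OrdConnected.out ‹_› (hKU haK) (hKU hbK)
  have hout : ∀ x, x ∉ Icc a b → ψ x = 0 := fun x hx => by
    have hxK : x ∉ K := fun hxK => hx ⟨csInf_le cK.bddBelow hxK, le_csSup cK.bddAbove hxK⟩
    have e1 : g x = 0 := image_eq_zero_of_notMem_tsupport fun hh => hxK (Or.inl hh)
    have e2 : φ₀ x = 0 := image_eq_zero_of_notMem_tsupport fun hh => hxK (Or.inr hh)
    simp [hψ, e1, e2]
  set Φ : ℝ → ℝ := fun x => ∫ t in a..x, ψ t with hΦ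
  have dΦ : ∀ x, HasDerivAt Φ (ψ x) x := fun x =>
    intervalIntegral.integral_hasDerivAt_right (sψ.continuous.intervalIntegrable _ _)
      (sψ.continuous.stronglyMeasurableAtFilter _ _) sψ.continuous.continuousAt
  have eΦ : deriv Φ = ψ := funext fun x => (dΦ x).deriv
  have sΦ : ContDiff ℝ ∞ Φ := by
    rw [contDiff_infty_iff_deriv, eΦ]
    exact ⟨fun x => (dΦ x).differentiableAt, sψ⟩
  have suppΦ : Function.support Φ ⊆ Icc a b := by
    intro x hx
    by_contra hxI
    refine hx ?_
    rcases lt_or_ge x a with hxa | hxa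
    · simp only [hΦ]
      rw [intervalIntegral.integral_symm, intervalIntegral.integral_of_le hxa.le,
        neg_eq_zero]
      refine integral_eq_zero_of_ae ?_
      refine (ae_restrict_iff' measurableSet_Ioc).mpr ?_
      filter_upwards [Measure.ae_ne volume a] with t ht1 ht2
      exact hout t fun h' => ht1 (le_antisymm ht2.2 h'.1)
    · have hxb : b < x := not_le.mp fun hh => hxI ⟨hxa, hh⟩
      simp only [hΦ]
      rw [intervalIntegral.integral_of_le hxa, ← integral_Icc_eq_integral_Ioc,
        setIntegral_eq_integral_of_forall_compl_eq_zero, zψ]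
      exact fun t ht => hout t fun h' => ht ⟨h'.1, h'.2.trans hxb.le⟩
  have tΦ : tsupport Φ ⊆ Icc a b := closure_minimal suppΦ isClosed_Icc
  have hz := h Φ sΦ (isCompact_Icc.of_isClosed_subset (isClosed_tsupport _) tΦ) (tΦ.trans hIU)
  have hz' : ∫ x, (g x • w x - m • φ₀ x • w x) = 0 := by
    rw [← hz]
    refine integral_congr_ae (Eventually.of_forall fun x => ?_)
    simp only [eΦ, hψ, sub_smul, mul_smul]
  rw [integral_sub (hint g h1 h2) ((hint φ₀ s0 c0).fun_smul m), integral_smul, sub_eq_zero] at hz'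
  simp only [smul_sub]
  rw [integral_sub (hint g h1 h2) (hgi.smul_const _), integral_smul_const, hz', sub_self]

/-- `u` agrees almost everywhere with `aL` on `(-∞, 0)` and with `aR` on `(0, ∞)`, where `aL` and
`aR` are primitives of `g` up to the origin. This is the description of `W¹₂(ℝ ∖ {0})` by
absolutely continuous representatives; `aL 0` and `aR 0` are the one-sided traces. -/
structure PiecewisePrimitive (u g aL aR : ℝ → ℂ) : Prop where
  left : IsPrimitive aL g (Iic 0)
  right : IsPrimitive aR g (Ici 0)
  ae_left : ∀ᵐ x, x ∈ Iio (0 : ℝ) → u x = aL x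
  ae_right : ∀ᵐ x, x ∈ Ioi (0 : ℝ) → u x = aR x

/-- Integration by parts on `ℝ ∖ {0}`. -/
theorem PiecewisePrimitive.integral_mul {u g aL aR v h bL bR : ℝ → ℂ}
    (H : PiecewisePrimitive u g aL aR) (K : PiecewisePrimitive v h bL bR)
    (h1 : Integrable fun x => u x * v x) (h2 : Integrable fun x => g x * v x + u x * h x) :
    ∫ x, (g x * v x + u x * h x) = aL 0 * bL 0 - aR 0 * bR 0 := by
  have eL : (fun x => g x * v x + u x * h x) =ᵐ[volume.restrict (Iio 0)]
      fun x => g x * bL x + aL x * h x := by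
    refine (ae_restrict_iff' measurableSet_Iio).mpr ?_
    filter_upwards [H.ae_left, K.ae_left] with x hx hx' hx0
    rw [hx hx0, hx' hx0]
  have eR : (fun x => g x * v x + u x * h x) =ᵐ[volume.restrict (Ioi 0)]
      fun x => g x * bR x + aR x * h x := by
    refine (ae_restrict_iff' measurableSet_Ioi).mpr ?_
    filter_upwards [H.ae_right, K.ae_right] with x hx hx' hx0
    rw [hx hx0, hx' hx0]
  have eL' : (fun x => u x * v x) =ᵐ[volume.restrict (Iio 0)] fun x => aL x * bL x := by
    refine (ae_restrict_iff' measurableSet_Iio).mpr ?_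
    filter_upwards [H.ae_left, K.ae_left] with x hx hx' hx0
    rw [hx hx0, hx' hx0]
  have eR' : (fun x => u x * v x) =ᵐ[volume.restrict (Ioi 0)] fun x => aR x * bR x := by
    refine (ae_restrict_iff' measurableSet_Ioi).mpr ?_
    filter_upwards [H.ae_right, K.ae_right] with x hx hx' hx0
    rw [hx hx0, hx' hx0]
  have IL := (H.left.mul K.left).integral_Iio (h1.integrableOn.congr eL')
    (h2.integrableOn.congr eL)
  have IR := (H.right.mul K.right).integral_Ioi (h1.integrableOn.congr eR')
    (h2.integrableOn.congr eR)
  rw [← integral_add_compl measurableSet_Iic h2, compl_Iic, integral_Iic_eq_integral_Iio,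
    integral_congr_ae eL, integral_congr_ae eR, IL, IR]
  exact (sub_eq_add_neg _ _).symm

theorem PiecewisePrimitive.conj {u g aL aR : ℝ → ℂ} (H : PiecewisePrimitive u g aL aR) :
    PiecewisePrimitive (fun x => starRingEnd ℂ (u x)) (fun x => starRingEnd ℂ (g x))
      (fun x => starRingEnd ℂ (aL x)) (fun x => starRingEnd ℂ (aR x)) where
  left := H.left.clm_comp Complex.conjCLE.toContinuousLinearMap
  right := H.right.clm_comp Complex.conjCLE.toContinuousLinearMap
  ae_left := by filter_upwards [H.ae_left] with x hx h0; rw [hx h0]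
  ae_right := by filter_upwards [H.ae_right] with x hx h0; rw [hx h0]

theorem IsPrimitive.of_contDiff_ofReal {φ : ℝ → ℝ} (hφ : ContDiff ℝ ∞ φ) :
    IsPrimitive (fun x => (φ x : ℂ)) (fun x => ((deriv φ x : ℝ) : ℂ)) univ :=
  (IsPrimitive.of_hasDerivAt
    (fun x => ((hφ.differentiable (by simp)) x).hasDerivAt)
    (hφ.continuous_deriv (by simp))).clm_comp Complex.ofRealCLM

theorem PiecewisePrimitive.isWeakDeriv {u g : L2} {aL aR : ℝ → ℂ}
    (H : PiecewisePrimitive u g aL aR) : IsWeakDeriv u g := by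
  intro φ h1 h2 h3
  have hφ := IsPrimitive.of_contDiff_ofReal h1
  have K : PiecewisePrimitive (fun x => (φ x : ℂ)) (fun x => ((deriv φ x : ℝ) : ℂ))
      (fun x => (φ x : ℂ)) (fun x => (φ x : ℂ)) :=
    ⟨hφ.mono (subset_univ _), hφ.mono (subset_univ _), Eventually.of_forall fun _ _ => rfl,
      Eventually.of_forall fun _ _ => rfl⟩
  have h0 : φ 0 = 0 := image_eq_zero_of_notMem_tsupport fun hh => h3 hh rfl
  have i1 := integrable_smul_L2 h1.continuous h2 u
  have i2 := integrable_smul_L2 h1.continuous h2 g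
  have i3 := integrable_smul_L2 (h1.continuous_deriv (by simp)) h2.deriv u
  have e := H.integral_mul K (by simpa [mul_comm] using i1)
    (by simpa [mul_comm] using i2.fun_add i3)
  simp only [h0, Complex.ofReal_zero, mul_zero, sub_self] at e
  rw [← add_eq_zero_iff_eq_neg, ← integral_add i3 i2, ← e]
  refine integral_congr_ae (Eventually.of_forall fun x => ?_)
  simp only [Complex.real_smul]
  ring

/-- On an open interval `U`, a locally integrable function with weak derivative `g` is almost
everywhere a primitive of `g`. -/
theorem exists_primitive_of_weakDeriv {U : Set ℝ} (hU : IsOpen U) [U.OrdConnected]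
    (hne : U.Nonempty) {u g : L2} (h0 : U ⊆ {0}ᶜ) (h : IsWeakDeriv u g) :
    ∃ a : ℝ → ℂ, IsPrimitive a g univ ∧ ∀ᵐ x, x ∈ U → u x = a x := by
  have hul : LocallyIntegrable (u : ℝ → ℂ) := (Lp.memLp u).locallyIntegrable (by norm_num)
  have hgl : LocallyIntegrable (g : ℝ → ℂ) := (Lp.memLp g).locallyIntegrable (by norm_num)
  have hG := IsPrimitive.of_locallyIntegrable hgl 0
  set G : ℝ → ℂ := fun x => 0 + ∫ t in (0 : ℝ)..x, g t with hGdef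
  have hGc : Continuous G := hG.continuous
  obtain ⟨c, hc⟩ := ae_eq_const_of_integral_deriv_smul_eq_zero hU hne
    (w := fun x => u x - G x) (hul.sub hGc.locallyIntegrable) (fun φ h1 h2 h3 => by
      have hφ := IsPrimitive.of_contDiff_ofReal h1
      have K : PiecewisePrimitive (fun x => (φ x : ℂ)) (fun x => ((deriv φ x : ℝ) : ℂ))
          (fun x => (φ x : ℂ)) (fun x => (φ x : ℂ)) :=
        ⟨hφ.mono (subset_univ _), hφ.mono (subset_univ _), Eventually.of_forall fun _ _ => rfl,
          Eventually.of_forall fun _ _ => rfl⟩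
      have H : PiecewisePrimitive G g G G :=
        ⟨hG.mono (subset_univ _), hG.mono (subset_univ _), Eventually.of_forall fun _ _ => rfl,
          Eventually.of_forall fun _ _ => rfl⟩
      have cd := h1.continuous_deriv (by simp)
      have i1 : Integrable fun x => φ x • G x :=
        hGc.locallyIntegrable.integrable_smul_left_of_hasCompactSupport h1.continuous h2
      have i2 := integrable_smul_L2 h1.continuous h2 g
      have i3 : Integrable fun x => deriv φ x • G x :=
        hGc.locallyIntegrable.integrable_smul_left_of_hasCompactSupport cd h2.deriv
      have i4 := integrable_smul_L2 cd h2.deriv u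
      have e := H.integral_mul K (by simpa [mul_comm] using i1)
        (by simpa [mul_comm] using i2.fun_add i3)
      have e' : ∫ x, (φ x • g x + deriv φ x • G x) = 0 := by
        rw [← sub_self (G 0 * φ 0), ← e]
        refine integral_congr_ae (Eventually.of_forall fun x => ?_)
        simp only [Complex.real_smul]
        ring
      rw [integral_add i2 i3] at e'
      simp only [smul_sub]
      rw [integral_sub i4 i3, h φ h1 h2 (h3.trans h0), eq_neg_of_add_eq_zero_left e', neg_neg,
        sub_self])
  refine ⟨fun x => c + ∫ t in (0 : ℝ)..x, g t, IsPrimitive.of_locallyIntegrable hgl c, ?_⟩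
  filter_upwards [hc] with x hx hxU
  rw [← hx hxU, hGdef]
  simp

theorem IsWeakDeriv.exists_piecewisePrimitive {u g : L2} (h : IsWeakDeriv u g) :
    ∃ aL aR, PiecewisePrimitive u g aL aR := by
  obtain ⟨aL, h1, h2⟩ := exists_primitive_of_weakDeriv isOpen_Iio nonempty_Iio
    (U := Iio 0) (fun x hx => ne_of_lt hx) h
  obtain ⟨aR, h3, h4⟩ := exists_primitive_of_weakDeriv isOpen_Ioi nonempty_Ioi
    (U := Ioi 0) (fun x hx => ne_of_gt hx) h
  exact ⟨aL, aR, h1.mono (subset_univ _), h3.mono (subset_univ _), h2, h4⟩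

theorem IsPrimitive.continuousOn_Iic {a b : ℝ → ℂ} (h : IsPrimitive a b (Iic 0)) :
    ContinuousOn a (Iic 0) := by
  have h0 : IsPrimitive (fun x => a (0 - x)) (fun x => -b (0 - x)) (Ici 0) :=
    h.comp_sub_left 0 fun x hx => by simpa using hx
  have h1 := h0.continuousOn_Ici.comp (continuous_neg.continuousOn (s := Iic (0 : ℝ)))
    fun x hx => by simpa using hx
  simpa [Function.comp_def] using h1

theorem PiecewisePrimitive.hasRightTrace {u : L2} {g aL aR : ℝ → ℂ}
    (H : PiecewisePrimitive u g aL aR) : HasRightTrace u (aR 0) :=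
  ⟨aR, H.right.continuousOn_Ici.mono Ioi_subset_Ici_self,
    (ae_restrict_iff' measurableSet_Ioi).mpr H.ae_right,
    (H.right.continuousOn_Ici 0 self_mem_Ici).mono_left (nhdsWithin_mono _ Ioi_subset_Ici_self)⟩

theorem PiecewisePrimitive.hasLeftTrace {u : L2} {g aL aR : ℝ → ℂ}
    (H : PiecewisePrimitive u g aL aR) : HasLeftTrace u (aL 0) :=
  ⟨aL, H.left.continuousOn_Iic.mono Iio_subset_Iic_self,
    (ae_restrict_iff' measurableSet_Iio).mpr H.ae_left,
    (H.left.continuousOn_Iic 0 self_mem_Iic).mono_left (nhdsWithin_mono _ Iio_subset_Iic_self)⟩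

theorem HasRightTrace.unique {u : L2} {c d : ℂ} (h : HasRightTrace u c) (h' : HasRightTrace u d) :
    c = d := by
  obtain ⟨v, v1, v2, v3⟩ := h
  obtain ⟨w, w1, w2, w3⟩ := h'
  have e : EqOn v w (Ioi 0) :=
    Measure.eqOn_open_of_ae_eq (v2.symm.trans w2) isOpen_Ioi v1 w1
  exact tendsto_nhds_unique (v3.congr' (e.eventuallyEq_of_mem self_mem_nhdsWithin)) w3

theorem HasLeftTrace.unique {u : L2} {c d : ℂ} (h : HasLeftTrace u c) (h' : HasLeftTrace u d) :
    c = d := by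
  obtain ⟨v, v1, v2, v3⟩ := h
  obtain ⟨w, w1, w2, w3⟩ := h'
  have e : EqOn v w (Iio 0) :=
    Measure.eqOn_open_of_ae_eq (v2.symm.trans w2) isOpen_Iio v1 w1
  exact tendsto_nhds_unique (v3.congr' (e.eventuallyEq_of_mem self_mem_nhdsWithin)) w3

/-! ### The quadratic form of `S_α` and uniqueness of the negative eigenvalue -/

section Form

theorem integrable_mul_conj_L2 (u v : L2) : Integrable fun x => u x * starRingEnd ℂ (v x) := by
  simpa [RCLike.inner_apply] using L2.integrable_inner (𝕜 := ℂ) v u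

theorem inner_L2_eq (u v : L2) : inner ℂ v u = ∫ x, u x * starRingEnd ℂ (v x) := by
  rw [L2.inner_def]
  simp [RCLike.inner_apply]

/-- Green's identity on `ℝ ∖ {0}`. -/
theorem inner_add_inner_weakDeriv {y' y'' z z' : L2} {c p q : ℂ} (hy : IsWeakDeriv y' y'')
    (hz : IsWeakDeriv z z') (hzR : HasRightTrace z c) (hzL : HasLeftTrace z c)
    (hyR : HasRightTrace y' p) (hyL : HasLeftTrace y' q) :
    inner ℂ z y'' + inner ℂ z' y' = (q - p) * starRingEnd ℂ c := by
  obtain ⟨aL, aR, H⟩ := hy.exists_piecewisePrimitive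
  obtain ⟨bL, bR, K⟩ := hz.exists_piecewisePrimitive
  have e1 := hzR.unique K.hasRightTrace
  have e2 := hzL.unique K.hasLeftTrace
  have e3 := hyR.unique H.hasRightTrace
  have e4 := hyL.unique H.hasLeftTrace
  have e := H.integral_mul K.conj (integrable_mul_conj_L2 _ _)
    ((integrable_mul_conj_L2 _ _).fun_add (integrable_mul_conj_L2 _ _))
  rw [inner_L2_eq, inner_L2_eq, ← integral_add (integrable_mul_conj_L2 _ _)
    (integrable_mul_conj_L2 _ _), e, ← e1, ← e2, ← e3, ← e4]
  ring

variable {W : ℝ → ℝ} (hW : MemLp W ∞ volume) {α : ℝ}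

theorem coeFn_potentialMul (y : L2) :
    (potentialMul W hW y : ℝ → ℂ) =ᵐ[volume] fun x => (W x : ℂ) * y x :=
  MemLp.coeFn_toLp (memLp_potential_mul hW y)

theorem inner_potentialMul (y z : L2) :
    inner ℂ z (potentialMul W hW y) = ∫ x, (W x : ℂ) * (y x * starRingEnd ℂ (z x)) := by
  rw [inner_L2_eq]
  refine integral_congr_ae ?_
  filter_upwards [coeFn_potentialMul hW y] with x hx
  rw [hx, mul_assoc]

theorem inner_potentialMul_symm (y z : L2) :
    inner ℂ z (potentialMul W hW y) = inner ℂ (potentialMul W hW z) y := by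
  rw [inner_potentialMul, inner_L2_eq]
  refine integral_congr_ae ?_
  filter_upwards [coeFn_potentialMul hW z] with x hx
  rw [hx, map_mul, Complex.conj_ofReal]
  ring

theorem re_inner_potentialMul_self_nonneg (h0 : ∀ᵐ x, 0 ≤ W x) (y : L2) :
    0 ≤ (inner ℂ y (potentialMul W hW y)).re := by
  have e : inner ℂ y (potentialMul W hW y) = ((∫ x, W x * ‖y x‖ ^ 2 : ℝ) : ℂ) := by
    rw [inner_potentialMul, ← integral_complex_ofReal]
    refine integral_congr_ae (Eventually.of_forall fun x => ?_)
    simp only [Complex.mul_conj, Complex.normSq_eq_norm_sq]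
    push_cast
    rfl
  rw [e, Complex.ofReal_re]
  refine integral_nonneg_of_ae ?_
  filter_upwards [h0] with x hx
  positivity

theorem exists_hasRightTrace (y : (S W hW α).domain) : ∃ c, HasRightTrace y c := by
  obtain ⟨_, c, _, _, h, _⟩ := y.2
  exact ⟨c, h⟩

/-- The sesquilinear form of `S_α`. -/
theorem inner_S_apply (y z : (S W hW α).domain) {c d : ℂ} (hc : HasRightTrace y c)
    (hd : HasRightTrace z d) :
    inner ℂ (z : L2) (S W hW α y) =
      inner ℂ (firstDeriv ⟨z, domS_le_W22 α z.2⟩ : L2) (firstDeriv ⟨y, domS_le_W22 α y.2⟩ : L2)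
        + inner ℂ (z : L2) (potentialMul W hW y) + α * (c * starRingEnd ℂ d) := by
  obtain ⟨_, c', p, q, h1, -, h3, h4, h5⟩ := y.2
  obtain ⟨_, d', p', q', k1, k2, -⟩ := z.2
  obtain rfl := hc.unique h1
  obtain rfl := hd.unique k1
  have g := inner_add_inner_weakDeriv (isWeakDeriv_secondDeriv ⟨y, domS_le_W22 α y.2⟩)
    (isWeakDeriv_firstDeriv ⟨z, domS_le_W22 α z.2⟩) k1 k2 h3 h4
  rw [S_apply, inner_add_right, inner_neg_right]
  linear_combination -g + starRingEnd ℂ d * h5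

theorem inner_S_symm (y z : (S W hW α).domain) :
    inner ℂ (z : L2) (S W hW α y) = inner ℂ (S W hW α z) (y : L2) := by
  obtain ⟨c, hc⟩ := exists_hasRightTrace hW y
  obtain ⟨d, hd⟩ := exists_hasRightTrace hW z
  rw [inner_S_apply hW y z hc hd, ← inner_conj_symm (S W hW α z) (y : L2),
    inner_S_apply hW z y hd hc]
  simp only [map_add, map_mul, inner_conj_symm, Complex.conj_ofReal, Complex.conj_conj]
  rw [inner_potentialMul_symm]
  ring

/-- The form is nonnegative on functions vanishing at the interaction point. -/
theorem re_inner_S_self_nonneg (h0 : ∀ᵐ x, 0 ≤ W x) (y : (S W hW α).domain)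
    (hy : HasRightTrace y 0) : 0 ≤ (inner ℂ (y : L2) (S W hW α y)).re := by
  rw [inner_S_apply hW y y hy hy]
  have h1 : 0 ≤ (inner ℂ (firstDeriv ⟨y, domS_le_W22 α y.2⟩ : L2)
      (firstDeriv ⟨y, domS_le_W22 α y.2⟩ : L2)).re :=
    inner_self_nonneg (𝕜 := ℂ)
  have h2 := re_inner_potentialMul_self_nonneg hW h0 y
  simpa using add_nonneg h1 h2

/-- An eigenfunction for a negative eigenvalue does not vanish at the origin. -/
theorem trace_ne_zero_of_eigenfunction (h0 : ∀ᵐ x, 0 ≤ W x) {y : (S W hW α).domain} {ν : ℝ}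
    (hν : ν < 0) (hne : (y : L2) ≠ 0) (hy : S W hW α y = (ν : ℂ) • (y : L2)) {c : ℂ}
    (hc : HasRightTrace y c) : c ≠ 0 := by
  rintro rfl
  have h := re_inner_S_self_nonneg hW h0 y hc
  rw [hy, inner_smul_right, inner_self_eq_norm_sq_to_K] at h
  have h1 : 0 < ‖(y : L2)‖ ^ 2 := by positivity
  have h2 : ((ν : ℂ) * (‖(y : L2)‖ : ℂ) ^ 2).re = ν * ‖(y : L2)‖ ^ 2 := by
    rw [← Complex.ofReal_pow, ← Complex.ofReal_mul, Complex.ofReal_re]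
  have h3 : 0 ≤ ν * ‖(y : L2)‖ ^ 2 := h2 ▸ h
  nlinarith

/-- Two negative eigenvalues coincide: otherwise the eigenfunctions are orthogonal and the form is
negative definite on their span, which contains a nonzero function vanishing at the origin. -/
theorem eigenvalue_unique (h0 : ∀ᵐ x, 0 ≤ W x) {y z : (S W hW α).domain} {μ ν : ℝ}
    (hμ : μ < 0) (hν : ν < 0) (hy0 : (y : L2) ≠ 0) (hz0 : (z : L2) ≠ 0)
    (hy : S W hW α y = (μ : ℂ) • (y : L2)) (hz : S W hW α z = (ν : ℂ) • (z : L2)) : μ = ν := by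
  by_contra hne
  obtain ⟨c, hc⟩ := exists_hasRightTrace hW y
  obtain ⟨d, hd⟩ := exists_hasRightTrace hW z
  have hd0 := trace_ne_zero_of_eigenfunction hW h0 hν hz0 hz hd
  have horth : inner ℂ (z : L2) (y : L2) = 0 := by
    have h := inner_S_symm hW y z
    rw [hy, hz, inner_smul_right, inner_smul_left, Complex.conj_ofReal] at h
    have h1 : ((μ : ℂ) - ν) * inner ℂ (z : L2) (y : L2) = 0 := by linear_combination h
    refine (mul_eq_zero.mp h1).resolve_left ?_
    rw [← Complex.ofReal_sub]
    exact_mod_cast sub_ne_zero.mpr hne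
  have horth' : inner ℂ (y : L2) (z : L2) = 0 := inner_eq_zero_symm.mp horth
  set w : (S W hW α).domain := d • y + (-c) • z with hw
  have ew : (w : L2) = d • (y : L2) + (-c) • (z : L2) := rfl
  have hw0 : HasRightTrace w 0 := by
    have := (hc.smul d).add (hd.smul (-c))
    rw [ew]
    convert this using 1
    ring
  have eS : S W hW α w = d • (μ : ℂ) • (y : L2) + (-c) • (ν : ℂ) • (z : L2) := by
    rw [hw, LinearPMap.map_add, LinearPMap.map_smul, LinearPMap.map_smul, hy, hz]
  have h := re_inner_S_self_nonneg hW h0 w hw0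
  have e : inner ℂ (w : L2) (S W hW α w) =
      ((μ * (‖d‖ ^ 2 * ‖(y : L2)‖ ^ 2) + ν * (‖c‖ ^ 2 * ‖(z : L2)‖ ^ 2) : ℝ) : ℂ) := by
    rw [eS, ew]
    simp only [inner_add_left, inner_add_right, inner_smul_left, inner_smul_right, horth, horth',
      inner_self_eq_norm_sq_to_K, map_neg]
    push_cast
    have n1 := Complex.mul_conj d
    have n2 := Complex.mul_conj c
    rw [Complex.normSq_eq_norm_sq] at n1 n2
    push_cast at n1 n2
    rw [← n1, ← n2]
    simp only [Complex.coe_algebraMap]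
    ring
  rw [e, Complex.ofReal_re] at h
  have h1 : 0 < ‖d‖ ^ 2 * ‖(y : L2)‖ ^ 2 := by positivity
  have h2 : 0 ≤ ‖c‖ ^ 2 * ‖(z : L2)‖ ^ 2 := by positivity
  nlinarith

/-- A negative eigenvalue is simple: the eigenfunction is determined by its value at the origin. -/
theorem finrank_eigenspace_eq_one (h0 : ∀ᵐ x, 0 ≤ W x) {y : (S W hW α).domain} {μ : ℝ}
    (hμ : μ < 0) (hy0 : (y : L2) ≠ 0) (hy : S W hW α y = (μ : ℂ) • (y : L2)) :
    Module.finrank ℂ (eigenspace (S W hW α) (μ : ℂ)) = 1 := by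
  obtain ⟨c, hc⟩ := exists_hasRightTrace hW y
  have hc0 := trace_ne_zero_of_eigenfunction hW h0 hμ hy0 hy hc
  have hmem : (y : L2) ∈ eigenspace (S W hW α) (μ : ℂ) := (mem_eigenspace _ _ _).mpr ⟨y.2, hy⟩
  refine finrank_eq_one (⟨y, hmem⟩ : eigenspace (S W hW α) (μ : ℂ))
    (fun h => hy0 (congrArg Subtype.val h)) ?_
  rintro ⟨z, hz⟩
  obtain ⟨hzd, hzS⟩ := (mem_eigenspace _ _ _).mp hz
  obtain ⟨d, hd⟩ := exists_hasRightTrace hW ⟨z, hzd⟩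
  refine ⟨d / c, Subtype.ext ?_⟩
  by_contra hne
  set w : (S W hW α).domain := (d / c) • y + (-1 : ℂ) • ⟨z, hzd⟩ with hw
  have ew : (w : L2) = (d / c) • (y : L2) + (-1 : ℂ) • z := rfl
  have hw0 : HasRightTrace w 0 := by
    have := (hc.smul (d / c)).add (hd.smul (-1))
    rw [ew]
    convert this using 1
    field_simp
    ring
  have eS : S W hW α w = (μ : ℂ) • (w : L2) := by
    rw [hw, LinearPMap.map_add, LinearPMap.map_smul, LinearPMap.map_smul, hy, hzS, ← hw, ew,
      smul_add, smul_comm, smul_comm (-1 : ℂ)]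
  refine trace_ne_zero_of_eigenfunction hW h0 hμ (fun hw' => hne ?_) eS hw0 rfl
  rw [ew, neg_one_smul, ← sub_eq_add_neg, sub_eq_zero] at hw'
  exact hw'

/-- Hence it suffices to exhibit one eigenfunction with negative eigenvalue. -/
theorem hasExactlyOneNegativeEigenvalue_of_isEigenvalue (h0 : ∀ᵐ x, 0 ≤ W x) {μ : ℝ} (hμ : μ < 0)
    (h : IsEigenvalue (S W hW α) (μ : ℂ)) : HasExactlyOneNegativeEigenvalue (S W hW α) := by
  obtain ⟨y, hy0, hy⟩ := h
  exact ⟨μ, hμ, ⟨y, hy0, hy⟩, finrank_eigenspace_eq_one hW h0 hμ hy0 hy,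
    fun ν hν ⟨_, hz0, hz⟩ => eigenvalue_unique hW h0 hν hμ hz0 hy0 hz hy⟩

end Form

/-! ### Differential equations with measurable coefficients depending on a parameter -/

section Caratheodory

variable {X E : Type*} [TopologicalSpace X] [FirstCountableTopology X] [NormedAddCommGroup E]
  [NormedSpace ℝ E]

theorem continuous_integral_max {g : X → ℝ → E}
    (hmeas : ∀ x, AEStronglyMeasurable (g x) volume) (hcont : ∀ t, Continuous fun x => g x t)
    (hbound : ∀ T, ∃ C, ∀ x, ∀ t ∈ Ioc 0 T, ‖g x t‖ ≤ C) :
    Continuous fun p : X × ℝ => ∫ t in (0 : ℝ)..max p.2 0, g p.1 t := by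
  rw [continuous_iff_continuousAt]
  rintro ⟨x₀, s₀⟩
  obtain ⟨C, hC⟩ := hbound (max s₀ 0 + 1)
  have hev : ∀ᶠ p : X × ℝ in 𝓝 (x₀, s₀), max p.2 0 < max s₀ 0 + 1 :=
    (continuous_snd.max continuous_const).continuousAt.eventually_lt continuousAt_const
      (lt_add_one _)
  have e : (fun p : X × ℝ => ∫ t in (0 : ℝ)..max p.2 0, g p.1 t) =
      fun p => ∫ t, (Ioc 0 (max p.2 0)).indicator (g p.1) t := by
    funext p
    rw [intervalIntegral.integral_of_le (le_max_right _ _), integral_indicator measurableSet_Ioc]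
  rw [e]
  refine continuousAt_of_dominated
    (bound := (Ioc 0 (max s₀ 0 + 1)).indicator fun _ => |C|)
    (Eventually.of_forall fun p => (hmeas _).indicator measurableSet_Ioc) ?_ ?_ ?_
  · filter_upwards [hev] with p hp
    refine Eventually.of_forall fun t => ?_
    by_cases ht : t ∈ Ioc 0 (max p.2 0)
    · have ht' : t ∈ Ioc 0 (max s₀ 0 + 1) := ⟨ht.1, ht.2.trans hp.le⟩
      rw [indicator_of_mem ht, indicator_of_mem ht']
      exact (hC _ t ht').trans (le_abs_self C)
    · rw [indicator_of_notMem ht, norm_zero]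
      exact indicator_nonneg (fun _ _ => abs_nonneg C) t
  · exact (integrable_indicator_iff measurableSet_Ioc).mpr (integrableOn_const (by simp))
  · filter_upwards [Measure.ae_ne volume (max s₀ 0)] with t ht
    have c2 : Continuous fun p : X × ℝ => max p.2 0 := continuous_snd.max continuous_const
    rcases lt_or_gt_of_ne ht with h | h
    · by_cases h0 : 0 < t
      · have : (fun p : X × ℝ => g p.1 t) =ᶠ[𝓝 (x₀, s₀)]
            fun p => (Ioc 0 (max p.2 0)).indicator (g p.1) t := by
          filter_upwards [continuousAt_const.eventually_lt c2.continuousAt h] with p hp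
          rw [indicator_of_mem (show t ∈ Ioc 0 (max p.2 0) from ⟨h0, hp.le⟩)]
        exact (((hcont t).comp continuous_fst).continuousAt).congr this
      · have : (fun p : X × ℝ => (Ioc 0 (max p.2 0)).indicator (g p.1) t) = fun _ => 0 :=
          funext fun p => indicator_of_notMem (fun hh => h0 hh.1) _
        rw [this]
        exact continuousAt_const
    · have : (fun _ : X × ℝ => (0 : E)) =ᶠ[𝓝 (x₀, s₀)]
          fun p => (Ioc 0 (max p.2 0)).indicator (g p.1) t := by
        filter_upwards [c2.continuousAt.eventually_lt continuousAt_const h] with p hp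
        rw [indicator_of_notMem (fun hh => absurd hp (not_lt.mpr hh.2))]
      exact continuousAt_const.congr this

open BoundedContinuousFunction in
/-- Global solvability of `Y' = F(x, t, Y)`, `Y(0) = y₀(x)` on `[0, ∞)`, in integrated form, for
`F` measurable in `t`, globally Lipschitz in `Y` and continuous in the parameter `x`. The solution
is jointly continuous because it is found as a fixed point in a space of functions of both
variables; the weight `exp (-γ t)` makes the integral operator a contraction there. -/
theorem exists_caratheodory_solution [CompleteSpace E] (F : X → ℝ → E → E) {L : ℝ} (hL : 0 ≤ L)
    (hmeas : ∀ x, ∀ Z : ℝ → E, Continuous Z → AEStronglyMeasurable (fun t => F x t (Z t)) volume)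
    (hlip : ∀ x t e e', ‖F x t e - F x t e'‖ ≤ L * ‖e - e'‖) (hzero : ∀ x t, F x t 0 = 0)
    (hcont : ∀ t, Continuous fun p : X × E => F p.1 t p.2) (y₀ : X → E) (hy₀ : Continuous y₀)
    {C : ℝ} (hC : ∀ x, ‖y₀ x‖ ≤ C) :
    ∃ Y : X → ℝ → E, (Continuous fun p : X × ℝ => Y p.1 p.2) ∧
      ∀ x, Y x 0 = y₀ x ∧ IsPrimitive (Y x) (fun t => F x t (Y x t)) (Ici 0) := by
  have hgrow : ∀ x t e, ‖F x t e‖ ≤ L * ‖e‖ := fun x t e => by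
    simpa [hzero] using hlip x t e 0
  set γ : ℝ := 2 * L + 1 with hγ
  have hγ0 : 0 < γ := by positivity
  have hLγ : L / γ ≤ 1 / 2 := by rw [div_le_div_iff₀ hγ0 two_pos]; linarith
  -- the integrand after the substitution `Y = exp (γ t) Z`
  set g : ((X × ℝ) →ᵇ E) → X → ℝ → E := fun Z x t => F x t (Real.exp (γ * t) • Z (x, t)) with hg
  have gc : ∀ (Z : (X × ℝ) →ᵇ E) x, Continuous fun t : ℝ => Real.exp (γ * t) • Z (x, t) :=
    fun Z x => by fun_prop
  have gm : ∀ Z x, AEStronglyMeasurable (g Z x) volume := fun Z x => hmeas x _ (gc Z x)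
  have gct : ∀ Z t, Continuous fun x => g Z x t := fun Z t =>
    (hcont t).comp (continuous_id.prodMk (by fun_prop))
  have gb : ∀ Z x t, ‖g Z x t‖ ≤ L * (Real.exp (γ * t) * ‖Z‖) := fun Z x t => by
    refine (hgrow x t _).trans ?_
    rw [norm_smul, Real.norm_of_nonneg (Real.exp_pos _).le]
    gcongr
    exact Z.norm_coe_le_norm _
  have gd : ∀ Z Z' x t, ‖g Z x t - g Z' x t‖ ≤ L * (Real.exp (γ * t) * dist Z Z') :=
    fun Z Z' x t => by
      refine (hlip x t _ _).trans ?_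
      rw [← smul_sub, norm_smul, Real.norm_of_nonneg (Real.exp_pos _).le, ← dist_eq_norm]
      gcongr
      exact BoundedContinuousFunction.dist_coe_le_dist _
  have gi : ∀ Z x s, IntervalIntegrable (g Z x) volume 0 s := fun Z x s => by
    have hc : Continuous fun t => L * (Real.exp (γ * t) * ‖Z‖) := by fun_prop
    exact (hc.intervalIntegrable _ _).mono_fun (gm Z x).restrict
      (Eventually.of_forall fun t => (gb Z x t).trans (le_abs_self _))
  have iexp : ∀ s D : ℝ, ∫ t in (0 : ℝ)..s, L * (Real.exp (γ * t) * D) =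
      L / γ * (Real.exp (γ * s) - 1) * D := fun s D => by
    rw [intervalIntegral.integral_const_mul, intervalIntegral.integral_mul_const,
      intervalIntegral.integral_comp_mul_left _ hγ0.ne', integral_exp]
    simp
    ring
  have bexp : ∀ s D : ℝ, 0 ≤ D →
      Real.exp (-(γ * s)) * (L / γ * (Real.exp (γ * s) - 1) * D) ≤ 1 / 2 * D := fun s D hD => by
    have h1 : Real.exp (-(γ * s)) * Real.exp (γ * s) = 1 := by rw [← Real.exp_add]; simp
    have h2 : Real.exp (-(γ * s)) * (L / γ * (Real.exp (γ * s) - 1) * D) =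
        L / γ * D * (1 - Real.exp (-(γ * s))) := by linear_combination (L / γ * D) * h1
    rw [h2]
    have h3 := Real.exp_pos (-(γ * s))
    calc L / γ * D * (1 - Real.exp (-(γ * s))) ≤ L / γ * D * 1 := by gcongr; linarith
      _ ≤ 1 / 2 * D := by rw [mul_one]; gcongr
  -- the integral operator
  set Ψ : ((X × ℝ) →ᵇ E) → X × ℝ → E := fun Z p =>
    Real.exp (-(γ * max p.2 0)) • (y₀ p.1 + ∫ t in (0 : ℝ)..max p.2 0, g Z p.1 t) with hΨ
  have Ψc : ∀ Z, Continuous (Ψ Z) := fun Z => by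
    refine Continuous.smul (by fun_prop) (Continuous.add (by fun_prop) ?_)
    refine continuous_integral_max (gm Z) (gct Z) fun T => ⟨L * (Real.exp (γ * T) * ‖Z‖), ?_⟩
    intro x t ht
    refine (gb Z x t).trans ?_
    gcongr
    exact ht.2
  have Ψb : ∀ Z p, ‖Ψ Z p‖ ≤ C + 1 / 2 * ‖Z‖ := fun Z p => by
    simp only [hΨ]
    set s := max p.2 0
    have hs : 0 ≤ s := le_max_right _ _
    have h1 : ‖∫ t in (0 : ℝ)..s, g Z p.1 t‖ ≤ L / γ * (Real.exp (γ * s) - 1) * ‖Z‖ := by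
      rw [← iexp]
      exact intervalIntegral.norm_integral_le_of_norm_le hs
        (Eventually.of_forall fun t _ => gb Z p.1 t)
        (Continuous.intervalIntegrable (by fun_prop) _ _)
    have h2 : Real.exp (-(γ * s)) ≤ 1 := Real.exp_le_one_iff.mpr (by nlinarith)
    rw [smul_add]
    refine (norm_add_le _ _).trans (add_le_add ?_ ?_)
    · rw [norm_smul, Real.norm_of_nonneg (Real.exp_pos _).le]
      exact (mul_le_of_le_one_left (norm_nonneg _) h2).trans (hC _)
    · rw [norm_smul, Real.norm_of_nonneg (Real.exp_pos _).le]
      exact (mul_le_mul_of_nonneg_left h1 (Real.exp_pos _).le).trans (bexp s _ (norm_nonneg _))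
  set Φ : ((X × ℝ) →ᵇ E) → ((X × ℝ) →ᵇ E) := fun Z =>
    BoundedContinuousFunction.ofNormedAddCommGroup (Ψ Z) (Ψc Z) _ (Ψb Z) with hΦ
  have hcontr : ContractingWith (1 / 2) Φ := by
    refine ⟨by norm_num, LipschitzWith.of_dist_le_mul fun Z Z' => ?_⟩
    refine (BoundedContinuousFunction.dist_le (by positivity)).mpr fun p => ?_
    change dist (Ψ Z p) (Ψ Z' p) ≤ _
    simp only [hΨ]
    set s := max p.2 0
    have hs : 0 ≤ s := le_max_right _ _
    have h1 : ‖∫ t in (0 : ℝ)..s, (g Z p.1 t - g Z' p.1 t)‖ ≤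
        L / γ * (Real.exp (γ * s) - 1) * dist Z Z' := by
      rw [← iexp]
      exact intervalIntegral.norm_integral_le_of_norm_le hs
        (Eventually.of_forall fun t _ => gd Z Z' p.1 t)
        (Continuous.intervalIntegrable (by fun_prop) _ _)
    rw [dist_eq_norm, ← smul_sub, add_sub_add_left_eq_sub,
      ← intervalIntegral.integral_sub (gi _ _ _) (gi _ _ _), norm_smul,
      Real.norm_of_nonneg (Real.exp_pos _).le]
    refine (mul_le_mul_of_nonneg_left h1 (Real.exp_pos _).le).trans
      ((bexp s _ dist_nonneg).trans (le_of_eq ?_))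
    norm_num
  set Z := ContractingWith.fixedPoint Φ hcontr with hZ
  have hfix : ∀ p, Ψ Z p = Z p := fun p =>
    DFunLike.congr_fun (ContractingWith.fixedPoint_isFixedPt hcontr) p
  have hsol : ∀ x s, 0 ≤ s →
      Real.exp (γ * s) • Z (x, s) = y₀ x + ∫ t in (0 : ℝ)..s, g Z x t := fun x s hs => by
    have h := hfix (x, s)
    simp only [hΨ, max_eq_left hs] at h
    rw [← h, smul_smul, ← Real.exp_add]
    simp
  refine ⟨fun x s => Real.exp (γ * s) • Z (x, s), by fun_prop, fun x => ⟨?_, ?_⟩⟩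
  · beta_reduce
    rw [hsol x 0 le_rfl, intervalIntegral.integral_same, add_zero]
  · intro r hr s hs
    refine ⟨(gi Z x r).symm.trans (gi Z x s), ?_⟩
    beta_reduce
    rw [hsol x r hr, hsol x s hs, add_sub_add_left_eq_sub,
      intervalIntegral.integral_interval_sub_left (gi Z x s) (gi Z x r)]

end Caratheodory

/-! ### Decaying solutions on a half-line -/

/-- `u` is the solution of `-u'' + q u = -k² u` on `[0, ∞)` that equals `exp (-k (x - R))` beyond
`R`, where `q` vanishes, and `p` is its derivative. -/
structure JostSolution (q : ℝ → ℝ) (R k : ℝ) (u p : ℝ → ℝ) : Prop where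
  deriv_left : IsPrimitive u p (Ici 0)
  deriv_right : IsPrimitive p (fun x => (q x + k ^ 2) * u x) (Ici 0)
  eq_left : ∀ x, R ≤ x → u x = Real.exp (-(k * (x - R)))
  eq_right : ∀ x, R ≤ x → p x = -k * Real.exp (-(k * (x - R)))

section Jost

variable {q : ℝ → ℝ} {M R K k : ℝ}

/-- Solving backwards from `R` gives decaying solutions whose data at `0` depend continuously
on `k`. -/
theorem exists_jostSolution (hqm : Measurable q) (hq0 : ∀ x, 0 ≤ q x) (hqM : ∀ x, q x ≤ M)
    (hqR : ∀ x, R ≤ x → q x = 0) (hR : 0 ≤ R) (hK : 0 ≤ K) :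
    ∃ u p : ℝ → ℝ → ℝ, (∀ k ∈ Icc 0 K, JostSolution q R k (u k) (p k)) ∧
      (Continuous fun k => u k 0) ∧ Continuous fun k => p k 0 := by
  have hM : 0 ≤ M := (hq0 0).trans (hqM 0)
  -- the parameter is clamped to `[0, K]` to have a uniform Lipschitz constant
  set κ : ℝ → ℝ := fun k => max 0 (min k K) with hκ
  have κc : Continuous κ := by fun_prop
  have κ0 : ∀ k, 0 ≤ κ k := fun k => le_max_left _ _
  have κK : ∀ k, κ k ≤ K := fun k => max_le hK (min_le_right _ _)
  have κsq : ∀ k, κ k ^ 2 ≤ K ^ 2 := fun k => pow_le_pow_left₀ (κ0 k) (κK k) 2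
  have κe : ∀ k ∈ Icc 0 K, κ k = k := fun k hk => by
    simp only [hκ, min_eq_left hk.2, max_eq_right hk.1]
  -- in the variable `t = R - x` the system for `(u, -u')` is an initial value problem at `t = 0`
  set F : ℝ → ℝ → ℝ × ℝ → ℝ × ℝ := fun k t e => (e.2, (q (R - t) + κ k ^ 2) * e.1) with hF
  have hlin : ∀ k t e, ‖F k t e‖ ≤ (1 + M + K ^ 2) * ‖e‖ := fun k t e => by
    have h1 : ‖e.1‖ ≤ ‖e‖ := norm_fst_le e
    have h2 : ‖e.2‖ ≤ ‖e‖ := norm_snd_le e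
    have h3 := hq0 (R - t)
    have h4 := hqM (R - t)
    have h5 := κsq k
    have h6 := sq_nonneg (κ k)
    refine max_le ?_ ?_
    · change ‖e.2‖ ≤ _
      nlinarith [norm_nonneg e, sq_nonneg K]
    · change ‖(q (R - t) + κ k ^ 2) * e.1‖ ≤ _
      rw [norm_mul, Real.norm_of_nonneg (by positivity : 0 ≤ q (R - t) + κ k ^ 2)]
      gcongr
      linarith
  obtain ⟨Y, Yc, hY⟩ := exists_caratheodory_solution F (L := 1 + M + K ^ 2) (by positivity)
    (fun k Z hZ => by
      refine (Measurable.prodMk ?_ ?_).aestronglyMeasurable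
      · exact measurable_snd.comp hZ.measurable
      · exact ((hqm.comp (measurable_const.sub measurable_id)).add_const _).mul
          (measurable_fst.comp hZ.measurable))
    (fun k t e e' => by
      have : F k t e - F k t e' = F k t (e - e') := by
        simp only [hF, Prod.mk_sub_mk, Prod.fst_sub, Prod.snd_sub, mul_sub]
      rw [this]
      exact hlin k t _)
    (fun k t => by simp [hF])
    (fun t => by simp only [hF]; fun_prop)
    (fun k => ((1 : ℝ), κ k)) (by fun_prop) (C := 1 + K)
    (fun k => by
      refine max_le ?_ ?_
      · simpa using hK
      · change ‖κ k‖ ≤ _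
        rw [Real.norm_of_nonneg (κ0 k)]
        linarith [κK k])
  set E : ℝ → ℝ → ℝ := fun k x => Real.exp (-(k * (x - R))) with hE
  have dE : ∀ k x, HasDerivAt (E k) (-k * E k x) x := fun k x => by
    have h := ((((hasDerivAt_id x).sub_const R).const_mul k).fun_neg).exp
    simp only [id, mul_one] at h
    exact h.congr_deriv (mul_comm _ _)
  have Ec : ∀ k, Continuous (E k) := fun k => by fun_prop
  have pE : ∀ k, IsPrimitive (E k) (fun x => -k * E k x) univ := fun k =>
    .of_hasDerivAt (dE k) (continuous_const.mul (Ec k))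
  refine ⟨fun k x => if x ≤ R then (Y k (R - x)).1 else E k x,
    fun k x => if x ≤ R then -(Y k (R - x)).2 else -k * E k x, fun k hk => ?_, ?_, ?_⟩
  · have hY1 := (hY k).2.clm_comp (ContinuousLinearMap.fst ℝ ℝ ℝ)
    have hY2 := (hY k).2.clm_comp (ContinuousLinearMap.snd ℝ ℝ ℝ)
    have hmaps : MapsTo (fun x => R - x) (Icc 0 R) (Ici 0) := fun x hx => sub_nonneg.mpr hx.2
    have hR1 : (Y k (R - R)).1 = E k R := by rw [sub_self, (hY k).1]; simp [hE]
    have hR2 : -(Y k (R - R)).2 = -k * E k R := by rw [sub_self, (hY k).1]; simp [hE, κe k hk]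
    have eu : ∀ x, R ≤ x → (if x ≤ R then (Y k (R - x)).1 else E k x) = E k x := fun x hx => by
      split_ifs with h
      · obtain rfl := le_antisymm h hx
        exact hR1
      · rfl
    have ep : ∀ x, R ≤ x → (if x ≤ R then -(Y k (R - x)).2 else -k * E k x) = -k * E k x :=
      fun x hx => by
        split_ifs with h
        · obtain rfl := le_antisymm h hx
          exact hR2
        · rfl
    refine ⟨?_, ?_, eu, ep⟩
    · refine IsPrimitive.Icc_union_Ici ?_ ?_ hR
      · refine (hY1.comp_sub_left R hmaps).congr (fun x hx => ?_) (fun x hx => ?_)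
        · exact (if_pos hx.2).symm
        · exact (if_pos hx.2).symm
      · exact ((pE k).mono (subset_univ _)).congr (fun x hx => (eu x hx).symm)
          (fun x hx => (ep x hx).symm)
    · refine IsPrimitive.Icc_union_Ici ?_ ?_ hR
      · refine (hY2.comp_sub_left R hmaps).neg.congr (fun x hx => ?_) (fun x hx => ?_)
        · exact (if_pos hx.2).symm
        · simp only [hF, ContinuousLinearMap.coe_snd', neg_neg, sub_sub_cancel, κe k hk]
          rw [if_pos hx.2]
      · refine (((pE k).const_mul (-k)).mono (subset_univ _)).congr
          (fun x hx => (ep x hx).symm) (fun x hx => ?_)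
        simp only [eu x hx, hqR x hx]
        ring
  · simp only [hR, if_true, sub_zero]
    exact continuous_fst.comp (Yc.comp (continuous_id.prodMk continuous_const))
  · simp only [hR, if_true, sub_zero]
    exact (continuous_snd.comp (Yc.comp (continuous_id.prodMk continuous_const))).neg

namespace JostSolution

variable {u p : ℝ → ℝ}

theorem mul_le (h : JostSolution q R k u p) (hq0 : ∀ x, 0 ≤ q x) {x : ℝ} (hx : x ∈ Icc 0 R) :
    u x * p x ≤ -k := by
  have hR : (0 : ℝ) ≤ R := hx.1.trans hx.2
  have h1 := ((h.deriv_left.mul h.deriv_right) x hx.1 R hR).2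
  have h2 : 0 ≤ ∫ t in x..R, (p t * p t + u t * ((q t + k ^ 2) * u t)) :=
    intervalIntegral.integral_nonneg hx.2 fun t _ => by
      have := hq0 t
      nlinarith [mul_self_nonneg (p t), mul_nonneg (add_nonneg this (sq_nonneg k))
        (mul_self_nonneg (u t))]
  have h3 := h.eq_left R le_rfl
  have h4 := h.eq_right R le_rfl
  simp only [sub_self, mul_zero, neg_zero, Real.exp_zero, mul_one] at h3 h4
  rw [h1] at h2
  beta_reduce at h2
  rw [h3, h4] at h2
  linarith

theorem one_le_sq (h : JostSolution q R k u p) (hq0 : ∀ x, 0 ≤ q x) (hk : 0 ≤ k) {x : ℝ}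
    (hx : x ∈ Icc 0 R) : 1 ≤ u x * u x := by
  have hR : (0 : ℝ) ≤ R := hx.1.trans hx.2
  have h1 := ((h.deriv_left.mul h.deriv_left) x hx.1 R hR).2
  have h2 : 0 ≤ ∫ t in x..R, -(p t * u t + u t * p t) :=
    intervalIntegral.integral_nonneg hx.2 fun t ht => by
      have := h.mul_le hq0 (x := t) ⟨hx.1.trans ht.1, ht.2⟩
      linarith
  have h3 := h.eq_left R le_rfl
  simp only [sub_self, mul_zero, neg_zero, Real.exp_zero] at h3
  rw [intervalIntegral.integral_neg, h1] at h2
  beta_reduce at h2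
  rw [h3] at h2
  linarith

theorem ne_zero (h : JostSolution q R k u p) (hq0 : ∀ x, 0 ≤ q x) (hk : 0 ≤ k) (hR : 0 ≤ R) :
    u 0 ≠ 0 := fun h0 => by
  have := h.one_le_sq hq0 hk ⟨le_rfl, hR⟩
  rw [h0] at this
  linarith

/-- The logarithmic derivative at `0` is at most that of `exp (-k x)`, since `p² - k² u²`
vanishes at `R` and has derivative `2 q u p ≤ 0`. -/
theorem div_le (h : JostSolution q R k u p) (hq0 : ∀ x, 0 ≤ q x) (hk : 0 ≤ k) (hR : 0 ≤ R) :
    p 0 / u 0 ≤ -k := by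
  have h0 : (0 : ℝ) ∈ Icc 0 R := ⟨le_rfl, hR⟩
  have h1 := (((h.deriv_right.mul h.deriv_right).add
    ((h.deriv_left.mul h.deriv_left).const_mul (-k ^ 2))) 0 h0.1 R hR).2
  have h2 : 0 ≤ ∫ t in (0 : ℝ)..R, -((q t + k ^ 2) * u t * p t + p t * ((q t + k ^ 2) * u t) +
      -k ^ 2 * (p t * u t + u t * p t)) :=
    intervalIntegral.integral_nonneg hR fun t ht => by
      have h3 := h.mul_le hq0 ht
      have h4 : 0 ≤ q t * -(u t * p t) := mul_nonneg (hq0 t) (by linarith)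
      linarith
  have h3 := h.eq_left R le_rfl
  have h4 := h.eq_right R le_rfl
  simp only [sub_self, mul_zero, neg_zero, Real.exp_zero, mul_one] at h3 h4
  rw [intervalIntegral.integral_neg, h1] at h2
  beta_reduce at h2
  rw [h3, h4] at h2
  have h5 := h.mul_le hq0 h0
  have hu := h.ne_zero hq0 hk hR
  set r := p 0 / u 0 with hr
  have hp : p 0 = r * u 0 := by rw [hr, div_mul_cancel₀ _ hu]
  rw [hp] at h2 h5
  have hu2 : 0 < u 0 ^ 2 := by positivity
  have h6 : 0 ≤ (r ^ 2 - k ^ 2) * u 0 ^ 2 := by linarith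
  have h7 : 0 ≤ r ^ 2 - k ^ 2 := nonneg_of_mul_nonneg_left h6 hu2
  have h8 : r * u 0 ^ 2 ≤ 0 := by linarith
  have h9 : r ≤ 0 := by
    by_contra hcon
    have := mul_pos (not_le.mp hcon) hu2
    linarith
  nlinarith

/-- At zero energy the logarithmic derivative is controlled by the Dirichlet integral of the
trial function `exp (-c x)`, because `u / u 0` minimises `∫ φ'² + q φ²` among functions equal to
`1` at the origin. -/
theorem neg_div_le (h : JostSolution q R 0 u p) (hqm : Measurable q) (hq0 : ∀ x, 0 ≤ q x)
    (hqM : ∀ x, q x ≤ M) (hR : 0 ≤ R) {c : ℝ} (hc : 0 < c) :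
    -(p 0 / u 0) ≤ c / 2 + ∫ x in (0 : ℝ)..R, q x * Real.exp (-(2 * c) * x) := by
  have hu := h.ne_zero hq0 le_rfl hR
  set m := p 0 / u 0 with hm
  set φ : ℝ → ℝ := fun x => Real.exp (-c * x) with hφ
  have dφ : ∀ x, HasDerivAt φ (-c * φ x) x := fun x => by
    have h := ((hasDerivAt_id x).const_mul (-c)).exp
    simp only [id, mul_one] at h
    convert! h using 1
    exact mul_comm _ _
  have φc : Continuous φ := by fun_prop
  have pφ : IsPrimitive φ (fun x => -c * φ x) (Ici 0) :=
    (IsPrimitive.of_hasDerivAt dφ (continuous_const.mul φc)).mono (subset_univ _)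
  set w : ℝ → ℝ := fun x => (u 0)⁻¹ * u x with hw
  set w' : ℝ → ℝ := fun x => (u 0)⁻¹ * p x with hw'
  have pw : IsPrimitive w w' (Ici 0) := h.deriv_left.const_mul _
  have pw' : IsPrimitive w' (fun x => q x * w x) (Ici 0) :=
    (h.deriv_right.const_mul _).congr (fun x _ => rfl) fun x _ => by simp only [hw]; ring
  have hR' : w' R = 0 := by
    have h4 := h.eq_right R le_rfl
    simp only [hw', h4, neg_zero, zero_mul, mul_zero]
  have w0 : w 0 = 1 := inv_mul_cancel₀ hu
  have w0' : w' 0 = m := by simp only [hw', hm]; ring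
  have φ0 : φ 0 = 1 := by simp [hφ]
  obtain ⟨iA, eA⟩ := (pw'.mul pφ) 0 self_mem_Ici R hR
  obtain ⟨iB, eB⟩ := (pw'.mul pw) 0 self_mem_Ici R hR
  simp only [hR', w0, w0', φ0, zero_mul, mul_one, zero_sub] at eA eB
  have iq : ∀ d : ℝ, IntervalIntegrable (fun x => q x * Real.exp (d * x)) volume 0 R := fun d => by
    have hc : Continuous fun x => M * Real.exp (d * x) := by fun_prop
    refine (hc.intervalIntegrable 0 R).mono_fun
      (hqm.mul (by fun_prop)).aestronglyMeasurable (Eventually.of_forall fun x => ?_)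
    beta_reduce
    rw [Real.norm_of_nonneg (mul_nonneg (hq0 x) (Real.exp_pos _).le)]
    exact (mul_le_mul_of_nonneg_right (hqM x) (Real.exp_pos _).le).trans (le_abs_self _)
  have eφ : ∀ x, φ x * φ x = Real.exp (-(2 * c) * x) := fun x => by
    simp only [hφ]; rw [← Real.exp_add]; ring_nf
  have iE : IntervalIntegrable (fun x => c ^ 2 * Real.exp (-(2 * c) * x)) volume 0 R :=
    Continuous.intervalIntegrable (by fun_prop) _ _
  have hsq : 0 ≤ ∫ x in (0 : ℝ)..R, ((c ^ 2 * Real.exp (-(2 * c) * x) +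
      q x * Real.exp (-(2 * c) * x)) - 2 * (q x * w x * φ x + w' x * (-c * φ x)) +
      (q x * w x * w x + w' x * w' x)) := by
    refine intervalIntegral.integral_nonneg hR fun x _ => ?_
    rw [← eφ]
    have h1 := mul_nonneg (hq0 x) (mul_self_nonneg (φ x - w x))
    have h2 := mul_self_nonneg (-c * φ x - w' x)
    linarith
  rw [intervalIntegral.integral_add ((iE.add (iq _)).sub (iA.const_mul 2)) iB,
    intervalIntegral.integral_sub (iE.add (iq _)) (iA.const_mul 2),
    intervalIntegral.integral_add iE (iq _), intervalIntegral.integral_const_mul 2, eA, eB,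
    intervalIntegral.integral_const_mul,
    intervalIntegral.integral_comp_mul_left _ (by linarith : -(2 * c) ≠ 0), integral_exp] at hsq
  have h1 : c ^ 2 * ((-(2 * c))⁻¹ • (Real.exp (-(2 * c) * R) - Real.exp (-(2 * c) * 0))) =
      c / 2 - c / 2 * Real.exp (-(2 * c) * R) := by
    simp only [mul_zero, Real.exp_zero, smul_eq_mul]
    field_simp
    ring
  rw [h1] at hsq
  have h2 := mul_pos (half_pos hc) (Real.exp_pos (-(2 * c) * R))
  linarith

end JostSolution

end Jost

/-! ### Construction of the eigenfunction -/

theorem integrable_exp_neg_mul_abs {c : ℝ} (hc : 0 < c) :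
    Integrable fun x : ℝ => Real.exp (-(c * |x|)) := by
  rw [← integrableOn_univ, ← Iic_union_Ioi (a := (0 : ℝ)), integrableOn_union]
  constructor
  · refine (integrableOn_exp_mul_Iic hc 0).congr_fun (fun x hx => ?_) measurableSet_Iic
    simp only [abs_of_nonpos (mem_Iic.mp hx)]
    ring_nf
  · refine (integrableOn_exp_mul_Ioi (neg_lt_zero.mpr hc) 0).congr_fun (fun x hx => ?_)
      measurableSet_Ioi
    simp only [abs_of_pos (mem_Ioi.mp hx)]
    ring_nf

/-- A continuous function on `[0, ∞)` that is eventually an exponential defines an even function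
in `L²(ℝ)`. -/
theorem memLp_two_comp_abs {u : ℝ → ℝ} (hu : ContinuousOn u (Ici 0)) {A R k : ℝ} (hk : 0 < k)
    (he : ∀ x, R ≤ x → u x = A * Real.exp (-(k * (x - R)))) :
    MemLp (fun x => (u |x| : ℂ)) 2 volume := by
  have hc : Continuous fun x : ℝ => u |x| :=
    hu.comp_continuous continuous_abs fun x => abs_nonneg x
  obtain ⟨C, hC⟩ := (isCompact_Icc (a := (0 : ℝ)) (b := R)).exists_bound_of_continuousOn
    (hu.mono Icc_subset_Ici_self)
  set D := (max C 0 + |A|) * Real.exp (k * R)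
  have hb : ∀ x : ℝ, |u (|x|)| ≤ D * Real.exp (-(k * |x|)) := fun x => by
    have hD : D * Real.exp (-(k * |x|)) = (max C 0 + |A|) * Real.exp (-(k * (|x| - R))) := by
      rw [mul_assoc, ← Real.exp_add]
      ring_nf
    rw [hD]
    rcases le_total R |x| with h | h
    · rw [he _ h, abs_mul, abs_of_pos (Real.exp_pos _)]
      gcongr
      exact le_add_of_nonneg_left (le_max_right _ _)
    · have h1 : 1 ≤ Real.exp (-(k * (|x| - R))) := Real.one_le_exp (by nlinarith)
      have h2 : |u (|x|)| ≤ max C 0 + |A| :=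
        ((hC _ ⟨abs_nonneg x, h⟩).trans (le_max_left _ _)).trans
          (le_add_of_nonneg_right (abs_nonneg A))
      exact h2.trans (le_mul_of_one_le_right (by positivity) h1)
  refine MemLp.ofReal ((memLp_two_iff_integrable_sq hc.aestronglyMeasurable).mpr ?_)
  refine ((integrable_exp_neg_mul_abs (c := 2 * k) (by positivity)).const_mul (D ^ 2)).mono'
    (hc.pow 2).aestronglyMeasurable (Eventually.of_forall fun x => ?_)
  rw [Real.norm_of_nonneg (sq_nonneg _), ← sq_abs]
  refine (pow_le_pow_left₀ (abs_nonneg _) (hb x) 2).trans (le_of_eq ?_)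
  rw [mul_pow, ← Real.exp_nat_mul]
  congr 2
  push_cast
  ring

/-- Real functions on the two half-lines, both parametrised by `[0, ∞)`, glue. -/
theorem piecewisePrimitive_of_real {aL bL aR bR : ℝ → ℝ} (hL : IsPrimitive aL bL (Ici 0))
    (hR : IsPrimitive aR bR (Ici 0)) {u g : ℝ → ℂ} (uR : ∀ᵐ x, 0 < x → u x = aR x)
    (gR : ∀ᵐ x, 0 < x → g x = bR x) (uL : ∀ᵐ x, x < 0 → u x = aL (0 - x))
    (gL : ∀ᵐ x, x < 0 → g x = ((-bL (0 - x) : ℝ) : ℂ)) :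
    PiecewisePrimitive u g (fun x => (aL (0 - x) : ℂ)) (fun x => (aR x : ℂ)) where
  left := by
    have h := (hL.comp_sub_left 0 (J := Iic 0) fun x hx => by simpa using hx).clm_comp
      Complex.ofRealCLM
    refine h.congr_ae (fun _ _ => rfl) ?_
    filter_upwards [gL, Measure.ae_ne volume 0] with x hx h0 hx0
    exact (hx (lt_of_le_of_ne hx0 h0)).symm
  right := by
    refine (hR.clm_comp Complex.ofRealCLM).congr_ae (fun _ _ => rfl) ?_
    filter_upwards [gR, Measure.ae_ne volume 0] with x hx h0 hx0
    exact (hx (lt_of_le_of_ne hx0 h0.symm)).symm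
  ae_left := uL
  ae_right := uR

/-- The element of `L²(ℝ)` equal to `a (-x)` on the left half-line and to `b x` on the right. -/
theorem exists_L2_glue {a b : ℝ → ℝ} (ha : MemLp (fun x => (a |x| : ℂ)) 2 volume)
    (hb : MemLp (fun x => (b |x| : ℂ)) 2 volume) :
    ∃ y : L2, (∀ᵐ x, 0 < x → y x = b x) ∧ ∀ᵐ x, x < 0 → y x = a (0 - x) := by
  have h := (ha.indicator (measurableSet_Iio (a := (0 : ℝ)))).add
    (hb.indicator (measurableSet_Ioi (a := (0 : ℝ))))
  refine ⟨h.toLp, ?_, ?_⟩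
  · filter_upwards [h.coeFn_toLp] with x hx h0
    rw [hx, Pi.add_apply, indicator_of_notMem (notMem_Iio.mpr h0.le),
      indicator_of_mem (mem_Ioi.mpr h0), abs_of_pos h0, zero_add]
  · filter_upwards [h.coeFn_toLp] with x hx h0
    rw [hx, Pi.add_apply, indicator_of_notMem (notMem_Ioi.mpr h0.le),
      indicator_of_mem (mem_Iio.mpr h0), abs_of_neg h0, add_zero, zero_sub]

/-- Matching the logarithmic derivatives of the two decaying solutions at the origin to `α`
produces an eigenfunction for `-k²`. -/
theorem isEigenvalue_of_jostSolution {W V : ℝ → ℝ} (hW : MemLp W ∞ volume) (hWV : W =ᵐ[volume] V)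
    (hV0 : ∀ x, 0 ≤ V x) {R k α : ℝ} (hR : 0 ≤ R) (hk : 0 < k) {uL pL uR pR : ℝ → ℝ}
    (hL : JostSolution (fun x => V (0 - x)) R k uL pL) (hRt : JostSolution V R k uR pR)
    (hα : pR 0 / uR 0 + pL 0 / uL 0 = α) :
    IsEigenvalue (S W hW α) ((-k ^ 2 : ℝ) : ℂ) := by
  have nR := hRt.ne_zero hV0 hk.le hR
  have nL := hL.ne_zero (fun x => hV0 _) hk.le hR
  set A := (uR 0)⁻¹ with hA
  set B := (uL 0)⁻¹ with hB
  have hm : ∀ {q u p : ℝ → ℝ} (c : ℝ), JostSolution q R k u p →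
      MemLp (fun x => ((c * u |x| : ℝ) : ℂ)) 2 volume := fun c h => by
    refine memLp_two_comp_abs (A := c) (R := R) (u := fun x => c * _)
      (continuousOn_const.mul h.deriv_left.continuousOn_Ici) hk fun x hx => ?_
    rw [h.eq_left x hx]
  have hm' : ∀ {q u p : ℝ → ℝ} (c : ℝ), JostSolution q R k u p →
      MemLp (fun x => ((c * p |x| : ℝ) : ℂ)) 2 volume := fun c h => by
    refine memLp_two_comp_abs (A := c * -k) (R := R) (u := fun x => c * _)
      (continuousOn_const.mul h.deriv_right.continuousOn_Ici) hk fun x hx => ?_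
    rw [h.eq_right x hx, mul_assoc]
  obtain ⟨y, yR, yL⟩ := exists_L2_glue (a := fun x => B * uL x) (b := fun x => A * uR x)
    (hm B hL) (hm A hRt)
  obtain ⟨y', yR', yL'⟩ := exists_L2_glue (a := fun x => -B * pL x) (b := fun x => A * pR x)
    (hm' (-B) hL) (hm' A hRt)
  -- the second derivative is prescribed by the eigenvalue equation
  set y'' : L2 := potentialMul W hW y + ((k ^ 2 : ℝ) : ℂ) • y with hy''
  have ey'' : ∀ᵐ x, y'' x = (V x + k ^ 2 : ℝ) * y x := by
    filter_upwards [Lp.coeFn_add (potentialMul W hW y) (((k ^ 2 : ℝ) : ℂ) • y),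
      Lp.coeFn_smul ((k ^ 2 : ℝ) : ℂ) y, coeFn_potentialMul hW y, hWV] with x h1 h2 h3 h4
    rw [hy'', h1, Pi.add_apply, h2, Pi.smul_apply, h3, h4, smul_eq_mul]
    push_cast
    ring
  have P1 := piecewisePrimitive_of_real (u := y) (g := y') (hL.deriv_left.const_mul B)
    (hRt.deriv_left.const_mul A) yR yR' yL (by
      filter_upwards [yL'] with x hx h0
      rw [hx h0, neg_mul])
  have P2 := piecewisePrimitive_of_real (u := y') (g := y'') (hL.deriv_right.const_mul (-B))
    (hRt.deriv_right.const_mul A) yR' (by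
      filter_upwards [ey'', yR] with x h1 h2 h0
      rw [h1, h2 h0]
      push_cast
      ring) yL' (by
      filter_upwards [ey'', yL] with x h1 h2 h0
      rw [h1, h2 h0]
      simp only [zero_sub, neg_neg]
      push_cast
      ring)
  have w1 := P1.isWeakDeriv
  have w2 := P2.isWeakDeriv
  have t1 := P1.hasRightTrace
  have t2 := P1.hasLeftTrace
  have t3 := P2.hasRightTrace
  have t4 := P2.hasLeftTrace
  simp only [sub_zero] at t1 t2 t3 t4
  have eA : A * uR 0 = 1 := inv_mul_cancel₀ nR
  have eB : B * uL 0 = 1 := inv_mul_cancel₀ nL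
  rw [eA] at t1
  rw [eB] at t2
  have hdom : y ∈ (S W hW α).domain := (mem_S_domain W hW α y).mpr
    ⟨y', y'', w1, w2, _, _, _, t1, t2, t3, t4, by
      rw [← hα, hA, hB]
      push_cast
      ring⟩
  refine ⟨⟨y, hdom⟩, fun h0 => ?_, ?_⟩
  · -- the eigenfunction has trace one at the origin
    have hz : HasRightTrace y 0 := by
      have h0' : y = 0 := h0
      rw [h0']
      exact HasRightTrace.zero
    simpa using t1.unique hz
  · have e1 : (firstDeriv ⟨y, domS_le_W22 α hdom⟩ : L2) = y' :=
      (isWeakDeriv_firstDeriv ⟨y, domS_le_W22 α hdom⟩).unique w1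
    have e2 : secondDeriv ⟨y, domS_le_W22 α hdom⟩ = y'' := by
      have h := isWeakDeriv_secondDeriv ⟨y, domS_le_W22 α hdom⟩
      rw [e1] at h
      exact h.unique w2
    rw [S_apply, e2, hy'']
    push_cast
    simp only [neg_smul, neg_add]
    abel

/-! ### The threshold -/

section Threshold

variable {V : ℝ → ℝ} {M R : ℝ}

theorem integrable_potential_mul_exp (hVm : Measurable V) (hV0 : ∀ x, 0 ≤ V x)
    (hVM : ∀ x, V x ≤ M) (hVR : ∀ x, R ≤ |x| → V x = 0) (α : ℝ) :
    Integrable fun x => V x * Real.exp (α * |x|) := by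
  have hc : Continuous fun x : ℝ => M * Real.exp (α * |x|) := by fun_prop
  have h1 : IntegrableOn (fun x => V x * Real.exp (α * |x|)) (Icc (-R) R) := by
    refine (hc.continuousOn.integrableOn_compact isCompact_Icc).mono'
      (hVm.mul (by fun_prop)).aestronglyMeasurable (Eventually.of_forall fun x => ?_)
    rw [Real.norm_of_nonneg (mul_nonneg (hV0 x) (Real.exp_pos _).le)]
    exact mul_le_mul_of_nonneg_right (hVM x) (Real.exp_pos _).le
  refine (integrableOn_iff_integrable_of_support_subset fun x hx => ?_).mp h1
  by_contra hxI
  refine hx ?_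
  have : R ≤ |x| := by
    by_contra hlt
    exact hxI (abs_le.mp (not_le.mp hlt).le)
  simp only [hVR x this, zero_mul]

theorem strictMono_thresholdFn (hVm : Measurable V) (hV0 : ∀ x, 0 ≤ V x)
    (hVM : ∀ x, V x ≤ M) (hVR : ∀ x, R ≤ |x| → V x = 0) : StrictMono (thresholdFn V) := by
  intro a b hab
  have h : ∫ x, V x * Real.exp (a * |x|) ≤ ∫ x, V x * Real.exp (b * |x|) := by
    refine integral_mono (integrable_potential_mul_exp hVm hV0 hVM hVR a)
      (integrable_potential_mul_exp hVm hV0 hVM hVR b) fun x => ?_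
    have := hV0 x
    dsimp only
    gcongr
  simp only [thresholdFn]
  linarith

theorem exists_thresholdFn_eq_zero (hVm : Measurable V) (hV0 : ∀ x, 0 ≤ V x)
    (hVM : ∀ x, V x ≤ M) (hVR : ∀ x, R ≤ |x| → V x = 0) :
    ∃ α₀ ≤ 0, thresholdFn V α₀ = 0 := by
  have hi : Integrable V := by
    simpa using integrable_potential_mul_exp hVm hV0 hVM hVR 0
  have hI : 0 ≤ ∫ x, V x := integral_nonneg hV0
  have hle : ∀ α ≤ 0, ∀ x, V x * Real.exp (α * |x|) ≤ V x := fun α hα x =>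
    mul_le_of_le_one_right (hV0 x)
      (Real.exp_le_one_iff.mpr (mul_nonpos_of_nonpos_of_nonneg hα (abs_nonneg x)))
  have hcont : ContinuousOn (thresholdFn V) (Iic 0) := by
    refine continuousOn_id.add (continuousOn_const.mul ?_)
    refine continuousOn_of_dominated (bound := V)
      (fun α _ => (integrable_potential_mul_exp hVm hV0 hVM hVR α).aestronglyMeasurable)
      (fun α hα => Eventually.of_forall fun x => ?_) hi
      (Eventually.of_forall fun x => Continuous.continuousOn (by fun_prop))
    rw [Real.norm_of_nonneg (mul_nonneg (hV0 x) (Real.exp_pos _).le)]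
    exact hle α hα x
  set a := -(2 * ∫ x, V x) with ha
  have ha0 : a ≤ 0 := by linarith
  have h1 : thresholdFn V a ≤ 0 := by
    have := integral_mono (integrable_potential_mul_exp hVm hV0 hVM hVR a) hi (hle a ha0)
    simp only [thresholdFn]
    linarith
  have h2 : 0 ≤ thresholdFn V 0 := by
    simp only [thresholdFn, zero_mul, Real.exp_zero, mul_one]
    linarith
  obtain ⟨α₀, hα₀, h⟩ := intermediate_value_Icc ha0 (hcont.mono Icc_subset_Iic_self) ⟨h1, h2⟩
  exact ⟨α₀, hα₀.2, h⟩

/-- Below the threshold the sum of the logarithmic derivatives of the two decaying solutions at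
the origin takes the value `α` for some `k > 0`: it exceeds `α` at `k = 0` by the choice of the
trial function `exp (α |x| / 2)`, and is at most `2 α` at `k = -α`. -/
theorem exists_jostSolution_matching (hVm : Measurable V) (hV0 : ∀ x, 0 ≤ V x)
    (hVM : ∀ x, V x ≤ M) (hR : 0 ≤ R) (hVR : ∀ x, R ≤ |x| → V x = 0) {α : ℝ} (hα : α < 0)
    (hf : thresholdFn V α < 0) :
    ∃ k > 0, ∃ uL pL uR pR, JostSolution (fun x => V (0 - x)) R k uL pL ∧
      JostSolution V R k uR pR ∧ pR 0 / uR 0 + pL 0 / uL 0 = α := by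
  have hV0' : ∀ x, 0 ≤ V (0 - x) := fun x => hV0 _
  have hVM' : ∀ x, V (0 - x) ≤ M := fun x => hVM _
  have hVm' : Measurable fun x => V (0 - x) := hVm.comp (measurable_const.sub measurable_id)
  have hK : 0 ≤ -α := by linarith
  obtain ⟨uR, pR, hJR, cuR, cpR⟩ := exists_jostSolution hVm hV0 hVM
    (fun x hx => hVR x (hx.trans (le_abs_self x))) hR hK
  obtain ⟨uL, pL, hJL, cuL, cpL⟩ := exists_jostSolution hVm' hV0' hVM'
    (fun x hx => hVR _ (by simpa using hx.trans (le_abs_self x))) hR hK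
  set F : ℝ → ℝ := fun k => pR k 0 / uR k 0 + pL k 0 / uL k 0 with hF
  have Fc : ContinuousOn F (Icc 0 (-α)) :=
    (cpR.continuousOn.div cuR.continuousOn fun k hk => (hJR k hk).ne_zero hV0 hk.1 hR).add
      (cpL.continuousOn.div cuL.continuousOn fun k hk => (hJL k hk).ne_zero hV0' hk.1 hR)
  have h0 : (0 : ℝ) ∈ Icc 0 (-α) := ⟨le_rfl, hK⟩
  have hK' : -α ∈ Icc 0 (-α) := ⟨hK, le_rfl⟩
  have F1 : F (-α) ≤ α := by
    have h1 := (hJR _ hK').div_le hV0 hK hR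
    have h2 := (hJL _ hK').div_le hV0' hK hR
    simp only [hF]
    linarith
  have F0 : α < F 0 := by
    have hc : 0 < -α / 2 := by linarith
    have h1 := (hJR 0 h0).neg_div_le hVm hV0 hVM hR hc
    have h2 := (hJL 0 h0).neg_div_le hVm' hV0' hVM' hR hc
    have eα : -(2 * (-α / 2)) = α := by ring
    rw [eα] at h1 h2
    have hi := integrable_potential_mul_exp hVm hV0 hVM hVR α
    have e1 : ∫ x in (0 : ℝ)..R, V x * Real.exp (α * x) =
        ∫ x in (0 : ℝ)..R, V x * Real.exp (α * |x|) :=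
      intervalIntegral.integral_congr fun x hx => by
        rw [uIcc_of_le hR] at hx
        simp only [abs_of_nonneg hx.1]
    have e2 : ∫ x in (0 : ℝ)..R, V (0 - x) * Real.exp (α * x) =
        ∫ x in (-R)..(0 : ℝ), V x * Real.exp (α * |x|) := by
      have h := intervalIntegral.integral_comp_sub_left (a := 0) (b := R)
        (fun x => V x * Real.exp (α * |x|)) 0
      rw [sub_zero, zero_sub] at h
      rw [← h]
      refine intervalIntegral.integral_congr fun x hx => ?_
      rw [uIcc_of_le hR] at hx
      simp only [zero_sub, abs_neg, abs_of_nonneg hx.1]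
    have h3 : (∫ x in (-R)..(0 : ℝ), V x * Real.exp (α * |x|)) +
        ∫ x in (0 : ℝ)..R, V x * Real.exp (α * |x|) ≤ ∫ x, V x * Real.exp (α * |x|) := by
      rw [intervalIntegral.integral_add_adjacent_intervals hi.intervalIntegrable
        hi.intervalIntegrable, intervalIntegral.integral_of_le (by linarith)]
      exact setIntegral_le_integral hi
        (Eventually.of_forall fun x => mul_nonneg (hV0 x) (Real.exp_pos _).le)
    rw [e1] at h1
    rw [e2] at h2
    simp only [thresholdFn] at hf
    simp only [hF]
    linarith
  obtain ⟨k, hk, hkα⟩ := intermediate_value_Icc' hK Fc ⟨F1, F0.le⟩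
  have hk0 : k ≠ 0 := by
    rintro rfl
    exact F0.ne hkα.symm
  exact ⟨k, lt_of_le_of_ne hk.1 hk0.symm, _, _, _, _, hJL k hk, hJR k hk, hkα⟩

/-- A bounded nonnegative potential with compact support has a representative for which all these
properties hold pointwise. -/
theorem exists_potential_representative {W : ℝ → ℝ} (hW : MemLp W ∞ volume)
    (hW_nonneg : ∀ᵐ x, 0 ≤ W x)
    (hW_supp : ∃ K : Set ℝ, IsCompact K ∧ ∀ᵐ x, x ∉ K → W x = 0) :
    ∃ (V : ℝ → ℝ) (M R : ℝ), Measurable V ∧ (∀ x, 0 ≤ V x) ∧ (∀ x, V x ≤ M) ∧ 0 ≤ R ∧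
      (∀ x, R ≤ |x| → V x = 0) ∧ W =ᵐ[volume] V := by
  obtain ⟨K, hK, hKW⟩ := hW_supp
  obtain ⟨r, hr⟩ := hK.isBounded.subset_closedBall 0
  set M := (eLpNormEssSup W volume).toReal with hM
  have hM0 : 0 ≤ M := ENNReal.toReal_nonneg
  have hfin : eLpNormEssSup W volume ≠ ⊤ := by
    have := hW.2
    rw [eLpNorm_exponent_top] at this
    exact this.ne
  have hWM : ∀ᵐ x, W x ≤ M := by
    filter_upwards [ae_le_eLpNormEssSup (f := W) (μ := volume)] with x hx
    have h1 := ENNReal.toReal_mono hfin hx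
    rw [toReal_enorm] at h1
    exact (le_abs_self _).trans h1
  set g := hW.1.mk W with hg
  have hgm : Measurable g := hW.1.stronglyMeasurable_mk.measurable
  set V : ℝ → ℝ := (Ioo (-(|r| + 1)) (|r| + 1)).indicator fun x => max 0 (min M (g x)) with hV
  refine ⟨V, M, |r| + 1, ?_, fun x => ?_, fun x => ?_, by positivity, fun x hx => ?_, ?_⟩
  · exact (measurable_const.max (measurable_const.min hgm)).indicator measurableSet_Ioo
  · exact indicator_nonneg (fun x _ => le_max_left _ _) x
  · exact indicator_le' (fun x _ => max_le hM0 (min_le_left _ _)) (fun x _ => hM0) x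
  · have hx' : x ∉ Ioo (-(|r| + 1)) (|r| + 1) := fun h => absurd (abs_lt.mpr h) (not_lt.mpr hx)
    exact indicator_of_notMem hx' _
  · filter_upwards [hW.1.ae_eq_mk, hWM, hW_nonneg, hKW] with x h1 h2 h3 h4
    by_cases hx : x ∈ Ioo (-(|r| + 1)) (|r| + 1)
    · rw [hV, indicator_of_mem hx, hg, ← h1, min_eq_right h2, max_eq_right h3]
    · rw [hV, indicator_of_notMem hx]
      refine h4 fun hxK => hx (abs_lt.mp ?_)
      have := hr hxK
      rw [mem_closedBall_zero_iff, Real.norm_eq_abs] at this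
      linarith [le_abs_self r]

end Threshold

end DeltaSchrodinger

theorem mainTheorem6 (W : ℝ → ℝ) (hW : MemLp W ∞ volume) (hW_nonneg : ∀ᵐ x, 0 ≤ W x)
    (hW_supp : ∃ K : Set ℝ, IsCompact K ∧ ∀ᵐ x, x ∉ K → W x = 0) :
    (∃ α₀ : ℝ, α₀ < 0 ∧ ∀ α < α₀,
      DeltaSchrodinger.HasExactlyOneNegativeEigenvalue (DeltaSchrodinger.S W hW α)) ∧
    (∃ α₀ : ℝ, α₀ ≤ 0 ∧ (∀ α : ℝ, DeltaSchrodinger.thresholdFn W α = 0 ↔ α = α₀) ∧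
      (¬ (∀ᵐ x, W x = 0) → α₀ < 0) ∧
      ∀ α < α₀,
        DeltaSchrodinger.HasExactlyOneNegativeEigenvalue (DeltaSchrodinger.S W hW α)) := by
  open DeltaSchrodinger in
  obtain ⟨V, M, R, hVm, hV0, hVM, hR, hVR, hWV⟩ :=
    exists_potential_representative hW hW_nonneg hW_supp
  have ef : thresholdFn W = thresholdFn V := funext fun α => by
    simp only [thresholdFn]
    congr 2
    refine integral_congr_ae ?_
    filter_upwards [hWV] with x hx
    rw [hx]
  have hmono := strictMono_thresholdFn hVm hV0 hVM hVR
  obtain ⟨α₀, hα₀, hz⟩ := exists_thresholdFn_eq_zero hVm hV0 hVM hVR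
  have key : ∀ α < α₀, HasExactlyOneNegativeEigenvalue (S W hW α) := fun α hα => by
    obtain ⟨k, hk, uL, pL, uR, pR, hL, hRt, hm⟩ := exists_jostSolution_matching hVm hV0 hVM hR hVR
      (hα.trans_le hα₀) (hz ▸ hmono hα)
    exact hasExactlyOneNegativeEigenvalue_of_isEigenvalue hW hW_nonneg
      (neg_lt_zero.mpr (pow_pos hk 2)) (isEigenvalue_of_jostSolution hW hWV hV0 hR hk hL hRt hm)
  -- for `W = 0` the threshold `α₀` is `0`, while the first claim asks for a negative number
  refine ⟨⟨min α₀ (-1), by simp, fun α hα => key α (hα.trans_le (min_le_left _ _))⟩,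
    α₀, hα₀, fun α => ?_, fun hne => lt_of_le_of_ne hα₀ ?_, key⟩
  · rw [ef, ← hz]
    exact hmono.injective.eq_iff
  · -- `f(0) = 2 ∫ W`, which vanishes only for the zero potential
    rintro rfl
    refine hne ?_
    have hi : Integrable V := by
      simpa using integrable_potential_mul_exp hVm hV0 hVM hVR 0
    have h0 : ∫ x, V x = 0 := by
      simpa [thresholdFn] using hz
    have hV : V =ᵐ[volume] 0 := (integral_eq_zero_iff_of_nonneg hV0 hi).mp h0
    exact hWV.trans hV
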